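/- Let $k$ be an algebraically closed field of characteristic $p>0$. **Notation.** For a commutative ring $R$ of characteristic $p$ and $c=(c_1,\dots,c_m)\in R^m$ let $\Delta_m(c)=\det\big(c_j^{p^{i-1}}\big)_{1\le i,j\le m}$ be the Moore determinant (with $\Delta_0=1$), and let $\hat c_i$ be the $(m-1)$-tuple obtained from $c$ by removing $c_i$. For a finite $\mathbb F_p$-subspace $V$ of $R$ let $P_V(Y)=\prod_{v\in V}(Y-v)\in R[Y]$ be its structural polynomial. A *space $L_{N,m}$* is an $m$-dimensional $\mathbb F_p$-vector space of meromorphic differential forms on $\mathbb P^1_k$ whose nonzero elements are logarithmic (of the form $dF/F$ with $F\in k(X)^\times$), have no zero in $k$, and have order $N-2$ at $\infty$; its set of poles is the set of $x\in k$ that are poles of some nonzero element. A tuple $(T_1,\dots,T_m)\in k[X]^m$ of polynomials of common degree $d\ge 1$ whose leading coefficients have nonzero Moore determinant *gives rise* to the tuple of forms $(\theta_1,\dots,\theta_m)$ if $\theta_i=(-1)^{i-1}\frac{\Delta_{m-1}(\hat T_i)}{\Delta_m(T)}\,dX$ for all $i$. For $c\in k^m$ with $\Delta_m(c)\neq 0$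 put $$\omega_i^{c}=\sum_{\epsilon\in\mathbb F_p^m}\frac{\epsilon_i}{X-\sum_j\epsilon_jc_j}\,dX,\qquad \Omega(\langle c\rangle_{\mathbb F_p})=\langle\omega^c_1,\dots,\omega^c_m\rangle_{\mathbb F_p}.$$ **Setting.** Let $n>1$, $1\le t\le n$, and let $a=(a_1,\dots,a_n)\in k^n$ satisfy $\Delta_n(a)\ne0$. Put $A=\langle a_1,\dots,a_n\rangle_{\mathbb F_p}$, $A_{n-t}=\langle a_1,\dots,a_{n-t}\rangle_{\mathbb F_p}$, $S=P_{A_{n-t}}\in k[X]$, $\tilde a_i=S(a_i)$ for $n-t+1\le i\le n$, and $\tilde A=\langle\tilde a_{n-t+1},\dots,\tilde a_n\rangle_{\mathbb F_p}$. Let $\omega_i=\omega_i^{a}$ $(1\le i\le n)$ and let $\tilde\omega_i$ $(n-t+1\le i\le n)$ be the forms attached in the same way to the $t$-tuple $\tilde a=(\tilde a_{n-t+1},\dots,\tilde a_n)$. Let $\mu,\tilde\mu,\eta\in k$ be the elements with $$\mu^{p^{n-1}}=\frac{-1}{\Delta_n(a)^{p-1}},\qquad \tilde\mu^{p^{t-1}}=\frac{-1}{\Delta_t(\tilde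 a)^{p-1}},\qquad \eta^{p^{t-1}}=\frac{(-1)^{n-t}}{\Delta_{n-t}(a_1,\dots,a_{n-t})^{p-1}},$$ and put $Q_i=\mu(a_iX^{p-1}-a_i^p)$ for $1\le i\le n$ and $\tilde Q_i=\tilde\mu(\tilde a_iX^{p-1}-\tilde a_i^p)$ for $n-t+1\le i\le n$. Let $\sigma:\mathbb P^1_k\to\mathbb P^1_k$ be the morphism induced by $X\mapsto S(X)$. **Proposition.** 0. $\Omega(A)$ is a space $L_{(p-1)p^{n-1},n}$ with set of poles $A\setminus\{0\}$, and $(Q_1,\dots,Q_n)$ is the unique $n$-tuple of polynomials of degree $p-1$ giving rise to $(\omega_1,\dots,\omega_n)$. Moreover $\Delta_t(\tilde a)\ne0$, $\Omega(\tilde A)$ is a space $L_{(p-1)p^{t-1},t}$ with set of poles $\tilde A\setminus\{0\}$, and $(\tilde Q_{n-t+1},\dots,\tilde Q_n)$ is the unique $t$-tuple of polynomials of degree $p-1$ giving rise to $(\tilde\omega_{n-t+1},\dots,\tilde\omega_n)$. The derivative of $S$ is the nonzero constant $S'=(-1)^{n-t}\Delta_{n-t}(a_1,\dots,a_{n-t})^{p-1}$,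 so $\sigma$ is étale over the affine line and $\eta^{p^{t-1}}=1/S'$. 1. For every $n-t+1\le i\le n$ we have $\omega_i=\sigma^\star(\tilde\omega_i)$. Consequently $\Omega^s:=\langle\omega_{n-t+1},\dots,\omega_n\rangle_{\mathbb F_p}\subset\Omega(A)$ equals $\sigma^\star(\Omega(\tilde A))$, and it is a space $L_{(p-1)p^{n-1},t}$. 2. The $t$-tuple $\big(\eta\,\tilde Q_{n-t+1}(S),\dots,\eta\,\tilde Q_n(S)\big)$ is the unique $t$-tuple of polynomials of degree $(p-1)p^{n-t}$ giving rise to the basis $(\sigma^\star\tilde\omega_{n-t+1},\dots,\sigma^\star\tilde\omega_n)$ of $\Omega^s$, and, with $\mathcal Q_{n-t}=\langle Q_1,\dots,Q_{n-t}\rangle_{\mathbb F_p}\subset k[X]$, $$(-1)^{n-t}\,\eta\,\tilde Q_i(S)=P_{\mathcal Q_{n-t}}(Q_i)\qquad\text{for all } n-t+1\le i\le n.$$ -/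

import Mathlib

open Polynomial
open scoped KaehlerDifferential

noncomputable section

namespace LSpace

/-! ### Meromorphic differential forms on the projective line -/

section Forms

/-- Meromorphic differential forms on the projective line over `k`:
the Kähler differentials of the function field `k(X)` over `k`. -/
abbrev Form (k : Type*) [Field k] : Type _ := Ω[RatFunc k⁄k]

variable {k : Type*} [Field k]

/-- The exact form `dF` of a rational function `F`. -/
abbrev dd (F : RatFunc k) : Form k := KaehlerDifferential.D k (RatFunc k) F

/-- A rational function regarded as given by a polynomial. -/
abbrev rat (P : k[X]) : RatFunc k := algebraMap k[X] (RatFunc k) P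

/-- Every form is `f dX` for exactly one rational function `f`. -/
theorem bijective_smul_dX :
    Function.Bijective
      (LinearMap.toSpanSingleton (RatFunc k) (Form k) (dd (RatFunc.X : RatFunc k))) := by
  have hX : dd (RatFunc.X : RatFunc k) =
      KaehlerDifferential.map k k k[X] (RatFunc k) (KaehlerDifferential.D k k[X] Polynomial.X) := by
    rw [KaehlerDifferential.map_D, RatFunc.algebraMap_X]
  constructor
  · have hne : dd (RatFunc.X : RatFunc k) ≠ 0 := by
      intro h0
      rw [hX] at h0
      obtain ⟨c, hc⟩ := (IsLocalizedModule.eq_zero_iff (nonZeroDivisors k[X])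
        (KaehlerDifferential.map k k k[X] (RatFunc k))).1 h0
      have := congrArg (KaehlerDifferential.polynomialEquiv k) hc
      rw [Submonoid.smul_def, map_smul, KaehlerDifferential.polynomialEquiv_D] at this
      simp at this
    intro f g h
    simp only [LinearMap.toSpanSingleton_apply] at h
    exact smul_left_injective (RatFunc k) hne h
  · rw [← LinearMap.range_eq_top, LinearMap.range_toSpanSingleton, eq_top_iff,
      ← KaehlerDifferential.span_range_map_derivation_of_isLocalization k k[X] (RatFunc k)
        (nonZeroDivisors k[X])]
    rw [Submodule.span_le]
    rintro _ ⟨P, rfl⟩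
    have h : KaehlerDifferential.map k k k[X] (RatFunc k) (KaehlerDifferential.D k k[X] P) =
        rat (derivative P) • dd (RatFunc.X : RatFunc k) := by
      rw [KaehlerDifferential.polynomial_D_apply, map_smul, hX, algebraMap_smul]
    rw [Function.comp_apply, h]
    exact Submodule.smul_mem _ _ (Submodule.mem_span_singleton_self _)

/-- The `k(X)`-linear bijection `f ↦ f dX` from rational functions to forms. -/
def ofCoeff : RatFunc k ≃ₗ[RatFunc k] Form k :=
  LinearEquiv.ofBijective _ bijective_smul_dX

theorem ofCoeff_apply (f : RatFunc k) : ofCoeff f = f • dd RatFunc.X := rfl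

/-- The rational function `f` with `ω = f dX`. -/
def coeff (ω : Form k) : RatFunc k := ofCoeff.symm ω

/-- The order at `x ∈ k` of a nonzero form `ω = f dX`, that is, the order of `f` at `x`. -/
def ordAt (x : k) (ω : Form k) : ℤ :=
  ((coeff ω).num.rootMultiplicity x : ℤ) - ((coeff ω).denom.rootMultiplicity x : ℤ)

/-- The order at `∞` of a nonzero form `ω = f dX`: the order of `f(1/X)` at `0`, minus `2`. The
order of `f(1/X)` at `0` is the degree of the denominator of `f` minus that of its numerator. -/
def ordInfty (ω : Form k) : ℤ := -(coeff ω).intDegree - 2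

/-- `ω = dF / F` for some nonzero rational function `F`. -/
def IsLogarithmic (ω : Form k) : Prop := ∃ F : RatFunc k, F ≠ 0 ∧ ω = F⁻¹ • dd F

/-- The pullback of forms under the morphism `X ↦ S(X)` given by a nonconstant polynomial `S`:
`f(X) dX` is sent to `f(S(X)) dS`. -/
def pullback (S : k[X]) (ω : Form k) : Form k :=
  RatFunc.eval RatFunc.C (rat S) (coeff ω) • dd (rat S)

end Forms

/-! ### Spaces `L_{m+1,n}` -/

section Spaces

variable {p : ℕ} [Fact p.Prime] {k : Type*} [Field k] [Algebra (ZMod p) k]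

/-- `Ω` is a space `L_{N,n}` (so `N = m + 1`): an `n`-dimensional `𝔽_p`-vector space of forms,
all of whose nonzero elements are logarithmic, have no zero in `k`, and have order
`m - 1 = N - 2` at `∞`. -/
structure IsLSpace (N n : ℕ) (Ω : Submodule (ZMod p) (Form k)) : Prop where
  finite : Module.Finite (ZMod p) Ω
  finrank_eq : Module.finrank (ZMod p) Ω = n
  logarithmic : ∀ ω ∈ Ω, ω ≠ 0 → IsLogarithmic ω
  no_zero : ∀ ω ∈ Ω, ω ≠ 0 → ∀ x : k, ordAt x ω ≤ 0
  ordInfty_eq : ∀ ω ∈ Ω, ω ≠ 0 → ordInfty ω = (N : ℤ) - 2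

/-- The set of `x ∈ k` that are poles of some nonzero form in `Ω`. -/
def poles (Ω : Submodule (ZMod p) (Form k)) : Set k :=
  {x | ∃ ω ∈ Ω, ω ≠ 0 ∧ ordAt x ω < 0}

/-- The form `∑_ε ε_i / (X - ∑_j ε_j a_j) dX`, the sum being over `ε ∈ 𝔽_p ^ n`. -/
def standardForm {n : ℕ} (a : Fin n → k) (i : Fin n) : Form k :=
  (∑ ε : Fin n → ZMod p,
    RatFunc.C (algebraMap (ZMod p) k (ε i)) / (RatFunc.X - RatFunc.C (∑ j, ε j • a j))) •
      dd RatFunc.X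

end Spaces

/-! ### Moore determinants and structural polynomials -/

section Moore

/-- The Moore determinant `Δ_n(a) = det (a_j ^ (p ^ i))`. -/
def moore {R : Type*} [CommRing R] (p : ℕ) {n : ℕ} (a : Fin n → R) : R :=
  (Matrix.of fun i j : Fin n => a j ^ p ^ (i : ℕ)).det

/-- The `(n-1)`-tuple obtained from `a` by removing its entry of index `i`. -/
def hat {R : Type*} {n : ℕ} (a : Fin n → R) (i : Fin n) : Fin (n - 1) → R :=
  fun j => if (j : ℕ) < i then a ⟨j, by omega⟩ else a ⟨j + 1, by omega⟩

/-- The structural polynomial `∏_{v ∈ V} (Y - v)` of a finite `𝔽_p`-subspace `V` of `R`. -/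
def structuralPoly {p : ℕ} {R : Type*} [CommRing R] [Algebra (ZMod p) R]
    (V : Submodule (ZMod p) R) : R[X] :=
  ∏ᶠ v : V, (Polynomial.X - Polynomial.C (v : R))

/-- The polynomials `Q_i = μ (a_i X^{p-1} - a_i^p) = μ Δ_2(a_i, X) / X`. -/
def standardPoly {k : Type*} [Field k] (p : ℕ) (μ : k) {n : ℕ} (a : Fin n → k) (i : Fin n) : k[X] :=
  Polynomial.C μ * (Polynomial.C (a i) * Polynomial.X ^ (p - 1) - Polynomial.C (a i ^ p))

/-- The tuple `Q` of polynomials of degree `d ≥ 1`, whose leading coefficients have nonzero Moore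
determinant, gives rise to the tuple of forms `ω`: with indices starting at `0`,
`ω_i = (-1)^i Δ_{n-1}(Q with Q_i removed) / Δ_n(Q) dX`. -/
structure GivesRiseTo {k : Type*} [Field k] (p d : ℕ) {n : ℕ} (Q : Fin n → k[X])
    (ω : Fin n → Form k) : Prop where
  one_le : 1 ≤ d
  natDegree_eq : ∀ i, (Q i).natDegree = d
  moore_leadingCoeff : moore p (fun i => (Q i).leadingCoeff) ≠ 0
  form_eq : ∀ i, ω i =
    (rat ((-1) ^ (i : ℕ) * moore p (hat Q i)) / rat (moore p Q)) • dd RatFunc.X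

end Moore

end LSpace

end

/-! Two facts carry the proof.

First, let `P` be the structural polynomial of an `n`-dimensional `A`. It is additive, so `P'` is a
nonzero constant `c`, and partial fractions give `∑ L(v)/(X - v) = c L / P` over `v ∈ A` whenever
`deg L < p ^ n` (`sum_eval_div_X_sub_C`). A combination of the standard forms with coefficients `e`
is of this shape, for the additive `L` that extends the linear form `e` on `A`. Its values on `A`
lie in `𝔽_p`, so `L ^ p - L` vanishes on `A` and equals `u P` for a constant `u`. The combination is
therefore `c u / (L ^ (p - 1) - 1) dX`, and zeros, poles and the order at infinity can be read off
(`exists_sum_smul_standardForm_eq`).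

Second, by Cramer's rule a tuple `T` with admissible degrees and leading coefficients gives rise to
the forms `w_j dX` exactly when `∑ T_j ^ p ^ i * w_j` is `0` for `i < n - 1` and `(-1) ^ (n - 1)`
for `i = n - 1` (`givesRiseTo_iff`). When the `w_j` are independent over `𝔽_p`, this system
determines `T` (`IsMooreDual.unique`). Every claim about tuples thus becomes the verification of a
linear system.

For the quotient by `A_r`, with `S` its structural polynomial, `P_A` is `S` followed by the
structural polynomial of `S(A)`. An additive `L` dual to the basis of `S(A)` becomes `L ∘ S` on `A`,
whence the pullback formula. Substituting `S` in the system of the small tuple introduces the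
constant `S'`, which `η` compensates. Finally, the monic additive polynomial killing `Q_1, …, Q_r`,
applied to the other `Q_i`, solves up to the sign `(-1) ^ r` the same system
(`IsMooreDual.additive`), and uniqueness gives the last identity. -/

namespace LSpace

/-! ### Structural polynomials as products over coefficient vectors. -/

section Combinations

variable {p : ℕ} [Fact p.Prime] {R : Type*} [CommRing R] [Algebra (ZMod p) R]

/-- The linear combination of the entries of `a` with coefficients `e`. -/
def comb {n : ℕ} (a : Fin n → R) (e : Fin n → ZMod p) : R := ∑ j, e j • a j

theorem comb_injective {n : ℕ} {a : Fin n → R} (h : LinearIndependent (ZMod p) a) :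
    Function.Injective (comb (p := p) a) := by
  intro e e' hee
  have := Fintype.linearIndependent_iff.1 h (e - e') (by
    simp only [Pi.sub_apply, sub_smul, Finset.sum_sub_distrib]
    exact sub_eq_zero.2 hee)
  ext j
  simpa [sub_eq_zero] using congrArg id (this j)

theorem mem_span_iff_comb {n : ℕ} (a : Fin n → R) (x : R) :
    x ∈ Submodule.span (ZMod p) (Set.range a) ↔ ∃ e, comb (p := p) a e = x :=
  Submodule.mem_span_range_iff_exists_fun _

theorem structuralPoly_span {n : ℕ} {a : Fin n → R} (h : LinearIndependent (ZMod p) a) :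
    structuralPoly (Submodule.span (ZMod p) (Set.range a)) =
      ∏ e : Fin n → ZMod p, (X - C (comb a e)) := by
  rw [structuralPoly, ← finprod_eq_prod_of_fintype]
  symm
  refine finprod_eq_of_bijective
    (fun e => (⟨comb a e, (mem_span_iff_comb a _).2 ⟨e, rfl⟩⟩ :
      Submodule.span (ZMod p) (Set.range a))) ⟨?_, ?_⟩ fun _ => rfl
  · intro e e' hee
    exact comb_injective h (congrArg Subtype.val hee)
  · rintro ⟨x, hx⟩
    obtain ⟨e, rfl⟩ := (mem_span_iff_comb a _).1 hx
    exact ⟨e, rfl⟩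

theorem structuralPoly_monic {n : ℕ} {a : Fin n → R} (h : LinearIndependent (ZMod p) a) :
    (structuralPoly (Submodule.span (ZMod p) (Set.range a))).Monic := by
  rw [structuralPoly_span h]
  exact monic_prod_of_monic _ _ fun e _ => monic_X_sub_C _

theorem structuralPoly_eval_comb {n : ℕ} {a : Fin n → R} (h : LinearIndependent (ZMod p) a)
    (e : Fin n → ZMod p) :
    (structuralPoly (Submodule.span (ZMod p) (Set.range a))).eval (comb a e) = 0 := by
  rw [structuralPoly_span h, eval_prod]
  exact Finset.prod_eq_zero (Finset.mem_univ e) (by simp)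

end Combinations

/-! ### Expansion of a Moore determinant along its last column. -/

section Cofactors

variable {p : ℕ} {R : Type*} [CommRing R]

/-- The cofactors of the last column of the Moore matrix of a tuple extending `a`. -/
def mooreCofactor (p : ℕ) {R : Type*} [CommRing R] {n : ℕ} (a : Fin n → R) (i : Fin (n + 1)) : R :=
  (-1) ^ ((i : ℕ) + n) * (Matrix.of fun l j : Fin n => a j ^ p ^ (i.succAbove l : ℕ)).det

theorem moore_snoc {n : ℕ} (a : Fin n → R) (y : R) :
    moore p (Fin.snoc a y : Fin (n + 1) → R) =
      ∑ i : Fin (n + 1), mooreCofactor p a i * y ^ p ^ (i : ℕ) := by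
  rw [moore, Matrix.det_succ_column _ (Fin.last n)]
  refine Finset.sum_congr rfl fun i _ => ?_
  have : ((Matrix.of fun i j : Fin (n + 1) => (Fin.snoc a y : Fin (n + 1) → R) j ^ p ^ (i : ℕ)).submatrix
      i.succAbove (Fin.last n).succAbove) =
      Matrix.of fun l j : Fin n => a j ^ p ^ (i.succAbove l : ℕ) := by
    ext l j
    simp [Fin.succAbove_last]
  rw [this, mooreCofactor]
  simp only [Fin.val_last, Matrix.of_apply, Fin.snoc_last]
  ring

theorem mooreCofactor_last {n : ℕ} (a : Fin n → R) :
    mooreCofactor p a (Fin.last n) = moore p a := by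
  simp [mooreCofactor, moore, Fin.succAbove_last, ← two_mul]

end Cofactors

/-! ### Moore determinants, independence, additivity of structural polynomials. -/

section MooreTheory

variable {p : ℕ} [Fact p.Prime] {R : Type*} [CommRing R] [IsDomain R] [Algebra (ZMod p) R]

variable (p R) in
theorem charP_of_algebra_zmod : CharP R p :=
  (Algebra.charP_iff (ZMod p) R p).1 inferInstance

theorem sum_smul_pow {ι : Type*} (s : Finset ι) (e : ι → ZMod p) (a : ι → R) (i : ℕ) :
    (∑ j ∈ s, e j • a j) ^ p ^ i = ∑ j ∈ s, e j • a j ^ p ^ i := by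
  have := charP_of_algebra_zmod p R
  have : ExpChar R p := .prime Fact.out
  rw [sum_pow_char_pow]
  simp [_root_.smul_pow, ZMod.pow_card_pow]

/-- Frobenius fixes `𝔽_p`, so a relation among the `a j` is a relation among the columns.
Conversely, a relation among the rows is an additive polynomial of degree less than `p ^ n` with `p
^ n` roots. -/
theorem moore_ne_zero_iff {n : ℕ} (a : Fin n → R) :
    moore p a ≠ 0 ↔ LinearIndependent (ZMod p) a := by
  constructor
  · intro h
    rw [Fintype.linearIndependent_iff]
    intro e he
    by_contra! hne
    obtain ⟨j, hj⟩ := hne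
    apply h
    rw [moore, ← Matrix.exists_mulVec_eq_zero_iff]
    refine ⟨fun j => algebraMap (ZMod p) R (e j), fun h0 => hj ?_, ?_⟩
    · have := congrFun h0 j
      simpa using this
    · ext i
      have h1 := sum_smul_pow (p := p) Finset.univ e a i
      rw [he, zero_pow (pow_ne_zero _ (Fact.out : p.Prime).ne_zero)] at h1
      simp only [Matrix.mulVec, dotProduct, Matrix.of_apply, Pi.zero_apply]
      rw [h1]
      exact Finset.sum_congr rfl fun j _ => by rw [Algebra.smul_def, mul_comm]
  · intro h h0
    rw [moore, ← Matrix.exists_vecMul_eq_zero_iff] at h0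
    obtain ⟨c, hc, h0⟩ := h0
    have hp : 1 < p := (Fact.out : p.Prime).one_lt
    -- The row relation `c` read as a polynomial: it vanishes at each `a j`, hence on their whole
    -- span.
    let F : R[X] := ∑ i : Fin n, C (c i) * X ^ p ^ (i : ℕ)
    have hcoeff (i : Fin n) : F.coeff (p ^ (i : ℕ)) = c i := by
      simp only [F, finsetSum_coeff, coeff_C_mul, coeff_X_pow]
      rw [Finset.sum_eq_single i]
      · simp
      · intro j _ hj
        rw [if_neg, mul_zero]
        intro hij
        exact hj (Fin.ext (Nat.pow_right_injective hp hij).symm)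
      · simp
    have heval (e : Fin n → ZMod p) : F.eval (comb a e) = 0 := by
      simp only [F, comb, eval_finsetSum, eval_mul, eval_C, eval_pow, eval_X, sum_smul_pow,
        Finset.mul_sum]
      rw [Finset.sum_comm]
      refine Finset.sum_eq_zero fun j _ => ?_
      have := congrFun h0 j
      simp only [Matrix.vecMul, dotProduct, Matrix.of_apply, Pi.zero_apply] at this
      simp only [mul_smul_comm, ← Finset.smul_sum, this, smul_zero]
    have hdeg : F.degree < (p ^ n : ℕ) := by
      refine (degree_sum_le _ _).trans_lt ((Finset.sup_lt_iff (WithBot.bot_lt_coe _)).2 ?_)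
      intro i _
      refine (degree_C_mul_X_pow_le _ _).trans_lt ?_
      exact_mod_cast Nat.pow_lt_pow_right hp i.2
    have hF : F = 0 := by
      classical
      refine eq_of_degree_sub_lt_of_eval_finset_eq
        (Finset.univ.image (comb (p := p) a)) ?_ ?_
      · rw [Finset.card_image_of_injective _ (comb_injective h)]
        simpa using hdeg
      · intro x hx
        obtain ⟨e, -, rfl⟩ := Finset.mem_image.1 hx
        simpa using heval e
    exact hc (funext fun i => by simpa [hF] using (hcoeff i).symm)

theorem structuralPoly_natDegree {n : ℕ} {a : Fin n → R} (h : LinearIndependent (ZMod p) a) :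
    (structuralPoly (Submodule.span (ZMod p) (Set.range a))).natDegree = p ^ n := by
  rw [structuralPoly_span h, natDegree_prod_of_monic _ _ fun e _ => monic_X_sub_C _]
  simp

theorem structuralPoly_eval_eq_zero {n : ℕ} {a : Fin n → R} (h : LinearIndependent (ZMod p) a)
    {x : R} (hx : (structuralPoly (Submodule.span (ZMod p) (Set.range a))).eval x = 0) :
    ∃ e, comb (p := p) a e = x := by
  rw [structuralPoly_span h, eval_prod, Finset.prod_eq_zero_iff] at hx
  obtain ⟨e, -, he⟩ := hx
  exact ⟨e, by simpa [sub_eq_zero, eq_comm] using he⟩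

/-- A polynomial of degree at most `p ^ n` vanishing on the span of `a` is a multiple of the
structural polynomial. -/
theorem eq_C_mul_structuralPoly {n : ℕ} {a : Fin n → R} (h : LinearIndependent (ZMod p) a)
    {F : R[X]} (hdeg : F.natDegree ≤ p ^ n) (hF : ∀ e, F.eval (comb (p := p) a e) = 0) :
    F = C (F.coeff (p ^ n)) * structuralPoly (Submodule.span (ZMod p) (Set.range a)) := by
  set P := structuralPoly (Submodule.span (ZMod p) (Set.range a))
  have hPd : P.natDegree = p ^ n := structuralPoly_natDegree h
  have hPm : P.Monic := structuralPoly_monic h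
  classical
  refine eq_of_degree_sub_lt_of_eval_finset_eq (Finset.univ.image (comb (p := p) a)) ?_ ?_
  · rw [Finset.card_image_of_injective _ (comb_injective h)]
    simp only [Finset.card_univ, Fintype.card_pi, ZMod.card, Finset.prod_const, Fintype.card_fin]
    rw [degree_lt_iff_coeff_zero]
    intro m hm
    rcases hm.eq_or_lt with rfl | hm
    · have : P.coeff (p ^ n) = 1 := by rw [← hPd]; exact hPm
      simp [this]
    · rw [coeff_sub, coeff_C_mul, coeff_eq_zero_of_natDegree_lt (hdeg.trans_lt hm),
        coeff_eq_zero_of_natDegree_lt (hPd.trans_lt hm), mul_zero, sub_zero]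
  · intro x hx
    obtain ⟨e, -, rfl⟩ := Finset.mem_image.1 hx
    rw [hF, eval_mul, structuralPoly_eval_comb h, mul_zero]

/-- Deleting the first row of powers leaves the Moore matrix of `a` with Frobenius applied to each
entry. -/
theorem mooreCofactor_zero {n : ℕ} (a : Fin n → R) :
    mooreCofactor p a 0 = (-1) ^ n * moore p a ^ p := by
  have := charP_of_algebra_zmod p R
  have : ExpChar R p := .prime Fact.out
  have := RingHom.map_det (frobenius R p) (Matrix.of fun i j : Fin n => a j ^ p ^ (i : ℕ))
  rw [frobenius_def] at this
  rw [mooreCofactor, moore, this]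
  simp only [Fin.val_zero, zero_add, Fin.succAbove_zero, Fin.val_succ]
  congr 2
  ext i j
  simp [frobenius_def, pow_succ, pow_mul]

/-- The right side is the Moore determinant of `(a, X)`: of degree at most `p ^ n`, zero on the span
of `a`, with top coefficient `moore p a`. Additivity and the linear coefficient of the structural
polynomial come from here. -/
theorem C_moore_mul_structuralPoly {n : ℕ} {a : Fin n → R} (h : LinearIndependent (ZMod p) a) :
    C (moore p a) * structuralPoly (Submodule.span (ZMod p) (Set.range a)) =
      ∑ i : Fin (n + 1), C (mooreCofactor p a i) * X ^ p ^ (i : ℕ) := by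
  have hp : 1 < p := (Fact.out : p.Prime).one_lt
  have key := eq_C_mul_structuralPoly h
    (F := ∑ i : Fin (n + 1), C (mooreCofactor p a i) * X ^ p ^ (i : ℕ)) ?_ ?_
  · rw [key]
    congr 2
    rw [finsetSum_coeff, Finset.sum_eq_single (Fin.last n)]
    · simp [mooreCofactor_last]
    · intro i _ hi
      rw [coeff_C_mul_X_pow, if_neg]
      intro hin
      exact hi (Fin.ext (Nat.pow_right_injective hp hin).symm)
    · simp
  · refine natDegree_sum_le_of_forall_le _ _ fun i _ => (natDegree_C_mul_X_pow_le _ _).trans ?_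
    exact Nat.pow_le_pow_right hp.le (Nat.lt_succ_iff.1 i.2)
  · intro e
    simp only [eval_finsetSum, eval_mul, eval_C, eval_pow, eval_X]
    rw [← moore_snoc]
    by_contra hne
    have hli := (moore_ne_zero_iff _).1 hne
    rw [Fintype.linearIndependent_iff] at hli
    -- The entry appended to `a` is the combination `e` of the others, so `(e, -1)` is a relation.
    have := hli (Fin.snoc e (-1)) (by simp [Fin.sum_univ_castSucc, comb]) (Fin.last n)
    simp at this

theorem structuralPoly_coeff {n : ℕ} {a : Fin n → R} (h : LinearIndependent (ZMod p) a)
    {m : ℕ} (hm : ∀ i, i ≤ n → m ≠ p ^ i) :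
    (structuralPoly (Submodule.span (ZMod p) (Set.range a))).coeff m = 0 := by
  have h1 := congrArg (Polynomial.coeff · m) (C_moore_mul_structuralPoly h)
  simp only [coeff_C_mul, finsetSum_coeff, coeff_X_pow] at h1
  rw [Finset.sum_eq_zero fun i _ => by
    rw [if_neg (hm i (Nat.lt_succ_iff.1 i.2)), mul_zero]] at h1
  exact (mul_eq_zero.1 h1).resolve_left ((moore_ne_zero_iff a).2 h)

/-- The structural polynomial of a finite `𝔽_p`-subspace is additive. -/
theorem structuralPoly_eq_sum {n : ℕ} {a : Fin n → R} (h : LinearIndependent (ZMod p) a) :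
    structuralPoly (Submodule.span (ZMod p) (Set.range a)) =
      ∑ i ∈ Finset.range (n + 1),
        C ((structuralPoly (Submodule.span (ZMod p) (Set.range a))).coeff (p ^ i)) * X ^ p ^ i := by
  have hp : 1 < p := (Fact.out : p.Prime).one_lt
  ext m
  simp only [finsetSum_coeff, coeff_C_mul_X_pow]
  by_cases hm : ∃ i ≤ n, m = p ^ i
  · obtain ⟨i, hi, rfl⟩ := hm
    rw [Finset.sum_eq_single i]
    · simp
    · intro j _ hj
      rw [if_neg fun hij => hj (Nat.pow_right_injective hp hij).symm]
    · intro hi'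
      exact absurd (Finset.mem_range.2 (Nat.lt_succ_iff.2 hi)) hi'
  · push Not at hm
    rw [structuralPoly_coeff h hm, Finset.sum_eq_zero]
    intro i hi
    rw [if_neg (hm i (Nat.lt_succ_iff.1 (Finset.mem_range.1 hi)))]

theorem structuralPoly_coeff_one {n : ℕ} {a : Fin n → R} (h : LinearIndependent (ZMod p) a) :
    (structuralPoly (Submodule.span (ZMod p) (Set.range a))).coeff 1 =
      (-1) ^ n * moore p a ^ (p - 1) := by
  have hp : 1 < p := (Fact.out : p.Prime).one_lt
  have h1 := congrArg (Polynomial.coeff · 1) (C_moore_mul_structuralPoly h)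
  simp only [coeff_C_mul, finsetSum_coeff, coeff_X_pow] at h1
  rw [Finset.sum_eq_single 0] at h1
  · apply mul_left_cancel₀ ((moore_ne_zero_iff a).2 h)
    rw [h1, mooreCofactor_zero]
    simp only [Fin.val_zero, pow_zero, if_true, mul_one]
    rw [mul_left_comm, mul_pow_sub_one (by omega)]
  · intro i _ hi
    rw [if_neg, mul_zero]
    intro h1i
    have h0 : (0 : ℕ) = i := Nat.pow_right_injective hp (by simpa using h1i)
    exact hi (Fin.ext h0.symm)
  · simp

theorem structuralPoly_derivative {n : ℕ} {a : Fin n → R} (h : LinearIndependent (ZMod p) a) :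
    derivative (structuralPoly (Submodule.span (ZMod p) (Set.range a))) =
      C ((-1) ^ n * moore p a ^ (p - 1)) := by
  have := charP_of_algebra_zmod p R
  rw [← structuralPoly_coeff_one h]
  conv_lhs => rw [structuralPoly_eq_sum h]
  rw [derivative_sum, Finset.sum_eq_single 0]
  · simp
  · intro i _ hi
    simp [derivative_X_pow, CharP.cast_eq_zero, hi]
  · simp

theorem structuralPoly_eval_comb_smul {n : ℕ} {a : Fin n → R} (h : LinearIndependent (ZMod p) a)
    {ι : Type*} (s : Finset ι) (e : ι → ZMod p) (x : ι → R) :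
    (structuralPoly (Submodule.span (ZMod p) (Set.range a))).eval (∑ j ∈ s, e j • x j) =
      ∑ j ∈ s, e j • (structuralPoly (Submodule.span (ZMod p) (Set.range a))).eval (x j) := by
  rw [structuralPoly_eq_sum h]
  simp only [eval_finsetSum, eval_mul, eval_C, eval_pow, eval_X, sum_smul_pow, Finset.mul_sum,
    Finset.smul_sum, mul_smul_comm]
  exact Finset.sum_comm

end MooreTheory

end LSpace

namespace LSpace

/-! ### Orders of forms `u / D dX` and stability of logarithmic forms. -/

section CoeffLemmas

variable {k : Type*} [Field k]

theorem coeff_smul_dX (f : RatFunc k) : coeff (f • dd RatFunc.X) = f := by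
  rw [← ofCoeff_apply, coeff, LinearEquiv.symm_apply_apply]

theorem coeff_smul_dX' (ω : Form k) : coeff ω • dd RatFunc.X = ω := by
  rw [← ofCoeff_apply, coeff, LinearEquiv.apply_symm_apply]

theorem smul_dX_injective :
    Function.Injective fun f : RatFunc k => f • (dd RatFunc.X : Form k) :=
  ofCoeff.injective

theorem rat_ne_zero {D : k[X]} (hD : D ≠ 0) : rat D ≠ 0 :=
  (map_ne_zero_iff _ (RatFunc.algebraMap_injective k)).2 hD

theorem coeff_add (ω ω' : Form k) : coeff (ω + ω') = coeff ω + coeff ω' :=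
  map_add ofCoeff.symm _ _

/-- The reduced numerator and denominator need not be `u` and `D`; cross-multiplying compares their
root multiplicities. -/
theorem ordAt_C_div (x u : k) (hu : u ≠ 0) {D : k[X]} (hD : D ≠ 0) :
    ordAt x ((rat (C u) / rat D) • dd RatFunc.X) = -(D.rootMultiplicity x : ℤ) := by
  rw [ordAt, coeff_smul_dX]
  set f := rat (C u) / rat D with hf
  have h1 : f.num * D = C u * f.denom := (RatFunc.num_mul_eq_mul_denom_iff hD).2 hf
  have hf0 : f ≠ 0 := div_ne_zero (rat_ne_zero (C_ne_zero.2 hu)) (rat_ne_zero hD)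
  have h2 := congrArg (rootMultiplicity x) h1
  rw [rootMultiplicity_mul (mul_ne_zero (RatFunc.num_ne_zero hf0) hD),
    rootMultiplicity_mul (mul_ne_zero (C_ne_zero.2 hu) f.denom_ne_zero),
    rootMultiplicity_C] at h2
  omega

theorem ordInfty_C_div (u : k) (hu : u ≠ 0) {D : k[X]} (hD : D ≠ 0) :
    ordInfty (k := k) ((rat (C u) / rat D) • dd RatFunc.X) = (D.natDegree : ℤ) - 2 := by
  rw [ordInfty, coeff_smul_dX, div_eq_mul_inv, RatFunc.intDegree_mul, RatFunc.intDegree_inv,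
    RatFunc.intDegree_polynomial, RatFunc.intDegree_polynomial, natDegree_C]
  · ring
  · exact rat_ne_zero ((C_ne_zero (R := k)).2 hu)
  · exact inv_ne_zero (rat_ne_zero hD)

theorem isLogarithmic_zero : IsLogarithmic (0 : Form k) :=
  ⟨1, one_ne_zero, by simp [dd]⟩

theorem IsLogarithmic.add {ω ω' : Form k} (h : IsLogarithmic ω) (h' : IsLogarithmic ω') :
    IsLogarithmic (ω + ω') := by
  obtain ⟨F, hF, rfl⟩ := h
  obtain ⟨G, hG, rfl⟩ := h'
  refine ⟨F * G, mul_ne_zero hF hG, ?_⟩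
  rw [dd, dd, dd, Derivation.leibniz, smul_add, smul_smul, smul_smul, add_comm]
  congr 2 <;> field_simp

theorem IsLogarithmic.nsmul {ω : Form k} (h : IsLogarithmic ω) (m : ℕ) :
    IsLogarithmic (m • ω) := by
  induction m with
  | zero => simpa using isLogarithmic_zero
  | succ m ih => simpa [succ_nsmul] using ih.add h

theorem IsLogarithmic.zmod_smul {p : ℕ} [Fact p.Prime] [Algebra (ZMod p) k] {ω : Form k}
    (h : IsLogarithmic ω) (c : ZMod p) : IsLogarithmic (c • ω) := by
  have : c • ω = c.val • ω := by
    conv_lhs => rw [← ZMod.natCast_zmod_val c, Nat.cast_smul_eq_nsmul]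
  rw [this]
  exact h.nsmul _

theorem IsLogarithmic.sum {ι : Type*} (s : Finset ι) {ω : ι → Form k}
    (h : ∀ i ∈ s, IsLogarithmic (ω i)) : IsLogarithmic (∑ i ∈ s, ω i) := by
  classical
  induction s using Finset.induction_on with
  | empty => simpa using isLogarithmic_zero
  | insert i s hi ih =>
    rw [Finset.sum_insert hi]
    exact (h i (Finset.mem_insert_self _ _)).add
      (ih fun j hj => h j (Finset.mem_insert_of_mem hj))

theorem X_sub_C_ne_zero (v : k) : (RatFunc.X - RatFunc.C v : RatFunc k) ≠ 0 := by
  have := rat_ne_zero (Polynomial.X_sub_C_ne_zero v)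
  simpa [rat] using this

theorem isLogarithmic_inv_X_sub_C (v : k) :
    IsLogarithmic ((RatFunc.X - RatFunc.C v)⁻¹ • (dd RatFunc.X : Form k)) := by
  refine ⟨_, X_sub_C_ne_zero v, ?_⟩
  congr 1
  rw [dd, dd, map_sub, ← RatFunc.algebraMap_eq_C, Derivation.map_algebraMap, sub_zero]

theorem degree_additive_lt {p : ℕ} [Fact p.Prime] {n : ℕ} (lam : Fin n → k) :
    (∑ i : Fin n, C (lam i) * X ^ p ^ (i : ℕ) : k[X]).degree < (p ^ n : ℕ) := by
  refine (degree_sum_le _ _).trans_lt ((Finset.sup_lt_iff (WithBot.bot_lt_coe _)).2 ?_)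
  intro i _
  refine (degree_C_mul_X_pow_le _ _).trans_lt ?_
  exact_mod_cast Nat.pow_lt_pow_right (Fact.out : p.Prime).one_lt i.2

end CoeffLemmas

/-! ### The spaces spanned by the standard forms. -/

section StandardForms

variable {p : ℕ} [Fact p.Prime] {k : Type*} [Field k] [Algebra (ZMod p) k] {n : ℕ}

theorem sum_smul_standardForm (a : Fin n → k) (e : Fin n → ZMod p) :
    ∑ j, e j • standardForm (p := p) a j =
      (∑ ε : Fin n → ZMod p, RatFunc.C (algebraMap (ZMod p) k (∑ j, e j * ε j)) /
        (RatFunc.X - RatFunc.C (comb a ε))) • dd RatFunc.X := by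
  simp only [standardForm, comb]
  simp_rw [← smul_assoc, ← Finset.sum_smul]
  congr 1
  simp_rw [Finset.smul_sum]
  rw [Finset.sum_comm]
  refine Finset.sum_congr rfl fun ε _ => ?_
  rw [map_sum (algebraMap (ZMod p) k),
    map_sum RatFunc.C (fun j => algebraMap (ZMod p) k (e j * ε j)), Finset.sum_div]
  refine Finset.sum_congr rfl fun j _ => ?_
  rw [Algebra.smul_def, IsScalarTower.algebraMap_apply (ZMod p) k (RatFunc k), map_mul, map_mul,
    RatFunc.algebraMap_eq_C, mul_div_assoc]

theorem isLogarithmic_standardForm (a : Fin n → k) (i : Fin n) :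
    IsLogarithmic (standardForm (p := p) a i) := by
  rw [standardForm, Finset.sum_smul]
  refine IsLogarithmic.sum _ fun ε _ => ?_
  have := (isLogarithmic_inv_X_sub_C (∑ j, ε j • a j)).zmod_smul (ε i)
  rwa [← smul_assoc, Algebra.smul_def, IsScalarTower.algebraMap_apply (ZMod p) k (RatFunc k),
    RatFunc.algebraMap_eq_C, ← div_eq_mul_inv] at this

theorem isLogarithmic_of_mem_span {ι : Type*} [Finite ι] {ω : ι → Form k}
    (h : ∀ i, IsLogarithmic (ω i)) {η : Form k}
    (hη : η ∈ Submodule.span (ZMod p) (Set.range ω)) : IsLogarithmic η := by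
  cases nonempty_fintype ι
  obtain ⟨e, rfl⟩ := (Submodule.mem_span_range_iff_exists_fun _).1 hη
  exact IsLogarithmic.sum _ fun i _ => (h i).zmod_smul _

/-- The derivative of the structural polynomial of the span of `a`. -/
def mooreConst (p : ℕ) {R : Type*} [CommRing R] {n : ℕ} (a : Fin n → R) : R :=
  (-1) ^ n * moore p a ^ (p - 1)

theorem mooreConst_ne_zero {a : Fin n → k} (h : LinearIndependent (ZMod p) a) :
    mooreConst p a ≠ 0 :=
  mul_ne_zero (pow_ne_zero _ (neg_ne_zero.2 one_ne_zero))
    (pow_ne_zero _ ((moore_ne_zero_iff a).2 h))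

/-- Partial fractions: the residue at a simple root `v` is `c L(v) / P'(v)`, which is `L(v)` because
`P'` is the constant `c`. The code multiplies Lagrange interpolation of `L` by `c / P`. -/
theorem sum_eval_div_X_sub_C {a : Fin n → k} (h : LinearIndependent (ZMod p) a)
    {L : k[X]} (hL : L.degree < (p ^ n : ℕ)) :
    ∑ ε : Fin n → ZMod p, RatFunc.C (L.eval (comb a ε)) / (RatFunc.X - RatFunc.C (comb a ε)) =
      rat (C (mooreConst p a) * L) /
        rat (structuralPoly (Submodule.span (ZMod p) (Set.range a))) := by
  classical
  set P := structuralPoly (Submodule.span (ZMod p) (Set.range a)) with hP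
  have hnod : Lagrange.nodal Finset.univ (comb (p := p) a) = P := by
    rw [hP, structuralPoly_span h, Lagrange.nodal]
  have hP0 : rat P ≠ 0 := rat_ne_zero (structuralPoly_monic h).ne_zero
  have hint := Lagrange.eq_interpolate (s := Finset.univ) (v := comb (p := p) a) (f := L)
    (comb_injective h).injOn (by simpa using hL)
  have hrat : rat (C (mooreConst p a) * L) = rat (C (mooreConst p a) *
      Lagrange.interpolate Finset.univ (comb (p := p) a) fun ε => L.eval (comb a ε)) := by
    rw [← hint]
  rw [eq_div_iff hP0, hrat]
  simp only [Lagrange.interpolate_apply, Finset.mul_sum, Finset.sum_mul, map_sum]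
  refine Finset.sum_congr rfl fun ε _ => ?_
  rw [Lagrange.basis_eq_prod_sub_inv_mul_nodal_div (Finset.mem_univ ε),
    ← Lagrange.nodal_erase_eq_nodal_div (Finset.mem_univ ε),
    Lagrange.nodalWeight_eq_eval_derivative_nodal (Finset.mem_univ ε), hnod, hP,
    structuralPoly_derivative h, ← hP, eval_C]
  have h1 : P = (X - C (comb a ε)) *
      Lagrange.nodal (Finset.univ.erase ε) (comb (p := p) a) := by
    rw [← hnod, Lagrange.nodal_eq_mul_nodal_erase (Finset.mem_univ ε)]
  have hX := X_sub_C_ne_zero (comb a ε)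
  have hc := mooreConst_ne_zero h
  have hC : (C (mooreConst p a) * (C (eval (comb a ε) L) *
      (C (mooreConst p a)⁻¹ * Lagrange.nodal (Finset.univ.erase ε) (comb (p := p) a))) : k[X]) =
      C (eval (comb a ε) L) * Lagrange.nodal (Finset.univ.erase ε) (comb (p := p) a) := by
    have : (C (mooreConst p a) * C (mooreConst p a)⁻¹ : k[X]) = 1 := by
      rw [← C_mul, mul_inv_cancel₀ hc, C_1]
    linear_combination (C (eval (comb a ε) L) *
      Lagrange.nodal (Finset.univ.erase ε) (comb (p := p) a)) * this
  change _ = rat (C (mooreConst p a) * (C (eval (comb a ε) L) *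
      (C (mooreConst p a)⁻¹ * Lagrange.nodal (Finset.univ.erase ε) (comb (p := p) a))))
  rw [hC, h1, rat, rat, map_mul, map_mul, map_sub, RatFunc.algebraMap_X, RatFunc.algebraMap_C,
    RatFunc.algebraMap_C]
  field_simp

theorem sum_smul_standardForm_eq {a : Fin n → k} (h : LinearIndependent (ZMod p) a)
    {L : k[X]} (hL : L.degree < (p ^ n : ℕ)) (e : Fin n → ZMod p)
    (hLe : ∀ ε, L.eval (comb a ε) = algebraMap (ZMod p) k (∑ j, e j * ε j)) :
    ∑ j, e j • standardForm (p := p) a j =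
      (rat (C (mooreConst p a) * L) /
        rat (structuralPoly (Submodule.span (ZMod p) (Set.range a)))) • dd RatFunc.X := by
  rw [sum_smul_standardForm, ← sum_eval_div_X_sub_C h hL]
  simp only [hLe]

/-- The additive polynomial of degree less than `p ^ n` with prescribed values on `a`. -/
theorem exists_interpolating_additive {a : Fin n → k} (h : LinearIndependent (ZMod p) a)
    (e : Fin n → ZMod p) :
    ∃ lam : Fin n → k, ∀ ε, (∑ i : Fin n, C (lam i) * X ^ p ^ (i : ℕ) : k[X]).eval (comb a ε) =
      algebraMap (ZMod p) k (∑ j, e j * ε j) := by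
  have hdet : IsUnit (Matrix.of fun i j : Fin n => a j ^ p ^ (i : ℕ)).det :=
    isUnit_iff_ne_zero.2 ((moore_ne_zero_iff a).2 h)
  set M := Matrix.of fun i j : Fin n => a j ^ p ^ (i : ℕ) with hM
  -- `lam` solves `∑ i, lam i * a j ^ p ^ i = e j` for every `j`; additivity extends this to all
  -- combinations.
  set lam := Matrix.vecMul (fun j => algebraMap (ZMod p) k (e j)) M⁻¹ with hlam
  have hl : Matrix.vecMul lam M = fun j => algebraMap (ZMod p) k (e j) := by
    rw [hlam, Matrix.vecMul_vecMul, Matrix.nonsing_inv_mul _ hdet, Matrix.vecMul_one]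
  refine ⟨lam, fun ε => ?_⟩
  simp only [comb, eval_finsetSum, eval_mul, eval_C, eval_pow, eval_X, sum_smul_pow,
    Finset.mul_sum]
  rw [Finset.sum_comm, map_sum]
  refine Finset.sum_congr rfl fun j _ => ?_
  have := congrFun hl j
  simp only [Matrix.vecMul, dotProduct, hM, Matrix.of_apply] at this
  rw [map_mul, ← this, mul_comm, ← Algebra.smul_def, Finset.smul_sum]
  exact Finset.sum_congr rfl fun i _ => mul_smul_comm _ _ _

/-- A nontrivial `𝔽_p`-linear combination of the standard forms is `u / D dX` for a constant `u`
and a polynomial `D` of degree `(p - 1) p ^ (n - 1)` whose roots are explicit. -/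
theorem exists_sum_smul_standardForm_eq {a : Fin n → k} (h : LinearIndependent (ZMod p) a)
    {e : Fin n → ZMod p} (he : e ≠ 0) :
    ∃ (u : k) (D : k[X]), u ≠ 0 ∧ D ≠ 0 ∧ D.natDegree = (p - 1) * p ^ (n - 1) ∧
      (∀ x, D.IsRoot x ↔ ∃ ε, comb a ε = x ∧ ∑ j, e j * ε j ≠ 0) ∧
      ∑ j, e j • standardForm (p := p) a j = (rat (C u) / rat D) • dd RatFunc.X := by
  have hp : 1 < p := (Fact.out : p.Prime).one_lt
  have hn : n ≠ 0 := by
    rintro rfl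
    exact he (Subsingleton.elim _ _)
  set P := structuralPoly (Submodule.span (ZMod p) (Set.range a)) with hP
  obtain ⟨lam, hlam⟩ := exists_interpolating_additive h e
  set L : k[X] := ∑ i : Fin n, C (lam i) * X ^ p ^ (i : ℕ) with hLdef
  have hLlt : L.degree < (p ^ n : ℕ) := degree_additive_lt lam
  have hLdeg : L.natDegree ≤ p ^ (n - 1) :=
    natDegree_sum_le_of_forall_le _ _ fun i _ => (natDegree_C_mul_X_pow_le _ _).trans
      (Nat.pow_le_pow_right hp.le (by omega))
  have hpp : p * p ^ (n - 1) = p ^ n := mul_pow_sub_one hn p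
  obtain ⟨j, hj⟩ := Function.ne_iff.1 he
  -- `L` takes the distinct values `e j ≠ 0` and `0`, so it is not constant.
  have hval : L.eval (comb (p := p) a (Pi.single j 1)) = algebraMap (ZMod p) k (e j) := by
    rw [hlam]; simp [Pi.single_apply]
  have hval0 : L.eval (comb (p := p) a 0) = 0 := by rw [hlam]; simp
  have hL0 : 0 < L.natDegree := by
    by_contra hcon
    have hc := eq_C_of_natDegree_eq_zero (Nat.eq_zero_of_not_pos hcon)
    rw [hc, eval_C] at hval hval0
    rw [hval0] at hval
    exact hj ((map_eq_zero_iff _ (algebraMap (ZMod p) k).injective).1 hval.symm)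
  have hLne : L ≠ 0 := by rintro h0; simp [h0] at hL0
  have hdeg : (L ^ p - L).natDegree = p * L.natDegree := by
    rw [natDegree_sub_eq_left_of_natDegree_lt, natDegree_pow]
    rw [natDegree_pow]
    nlinarith
  -- The values of `L` on the span lie in `𝔽_p`, where `y ^ p = y`.
  have hLp : L ^ p - L = C ((L ^ p - L).coeff (p ^ n)) * P := by
    refine eq_C_mul_structuralPoly h ?_ ?_
    · rw [hdeg, ← hpp]
      exact Nat.mul_le_mul_left _ hLdeg
    · intro ε
      rw [eval_sub, eval_pow, hlam, ← map_pow, ZMod.pow_card, sub_self]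
  set u := (L ^ p - L).coeff (p ^ n)
  have hu : u ≠ 0 := by
    intro h0
    rw [h0, C_0, zero_mul] at hLp
    rw [hLp, natDegree_zero] at hdeg
    have : 0 < p * L.natDegree := by positivity
    omega
  -- Since `u ≠ 0`, comparing degrees in `L ^ p - L = u P` fixes the degree of `L`.
  have hLd : L.natDegree = p ^ (n - 1) := by
    rw [hLp, natDegree_C_mul hu, structuralPoly_natDegree h, ← hpp] at hdeg
    exact (Nat.eq_of_mul_eq_mul_left (by omega) hdeg).symm
  have hmul : L * (L ^ (p - 1) - 1) = C u * P := by
    rw [← hLp, mul_sub, mul_pow_sub_one (by omega), mul_one]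
  have hD0 : L ^ (p - 1) - 1 ≠ 0 := by
    intro h0
    rw [h0, mul_zero] at hmul
    exact mul_ne_zero (C_ne_zero.2 hu) (structuralPoly_monic h).ne_zero hmul.symm
  -- From `L (L ^ (p - 1) - 1) = u P`, the factor `L` cancels in `c L / P`. The roots left are the
  -- points of the span where `L` is nonzero.
  refine ⟨mooreConst p a * u, L ^ (p - 1) - 1, mul_ne_zero (mooreConst_ne_zero h) hu, hD0,
    ?_, ?_, ?_⟩
  · rw [← C_1, natDegree_sub_C, natDegree_pow, hLd]
  · intro x
    constructor
    · intro hx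
      have h1 := congrArg (eval x) hmul
      rw [eval_mul, eval_mul, hx.eq_zero, mul_zero, eval_C] at h1
      obtain ⟨ε, rfl⟩ := structuralPoly_eval_eq_zero h
        ((mul_eq_zero.1 h1.symm).resolve_left hu)
      refine ⟨ε, rfl, fun h0 => ?_⟩
      rw [IsRoot, eval_sub, eval_pow, hlam, h0, map_zero, zero_pow (by omega)] at hx
      simp at hx
    · rintro ⟨ε, rfl, hε⟩
      rw [IsRoot, eval_sub, eval_pow, hlam, ← map_pow, ZMod.pow_card_sub_one_eq_one hε]
      simp
  · rw [sum_smul_standardForm_eq h hLlt e hlam]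
    congr 1
    rw [div_eq_div_iff (rat_ne_zero (structuralPoly_monic h).ne_zero) (rat_ne_zero hD0),
      ← map_mul, ← map_mul]
    congr 1
    rw [C_mul]
    linear_combination C (mooreConst p a) * hmul

theorem linearIndependent_standardForm {a : Fin n → k} (h : LinearIndependent (ZMod p) a) :
    LinearIndependent (ZMod p) (standardForm (p := p) a) := by
  rw [Fintype.linearIndependent_iff]
  intro e he
  by_contra! hne
  obtain ⟨u, D, hu, hD, -, -, heq⟩ := exists_sum_smul_standardForm_eq h
    (e := e) (fun h0 => by obtain ⟨j, hj⟩ := hne; exact hj (congrFun h0 j))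
  rw [he] at heq
  have := smul_dX_injective (k := k) (a₁ := 0) (by simpa using heq)
  exact div_ne_zero (rat_ne_zero (C_ne_zero.2 hu)) (rat_ne_zero hD) this.symm

theorem isLSpace_standard {a : Fin n → k} (h : LinearIndependent (ZMod p) a) :
    IsLSpace ((p - 1) * p ^ (n - 1)) n
      (Submodule.span (ZMod p) (Set.range (standardForm (p := p) a))) := by
  have key (ω) (hω : ω ∈ Submodule.span (ZMod p) (Set.range (standardForm (p := p) a)))
      (h0 : ω ≠ 0) : ∃ (u : k) (D : k[X]), u ≠ 0 ∧ D ≠ 0 ∧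
        D.natDegree = (p - 1) * p ^ (n - 1) ∧ ω = (rat (C u) / rat D) • dd RatFunc.X := by
    obtain ⟨e, rfl⟩ := (Submodule.mem_span_range_iff_exists_fun _).1 hω
    obtain ⟨u, D, hu, hD, hd, -, heq⟩ := exists_sum_smul_standardForm_eq h (e := e) (by
      rintro rfl; simp at h0)
    exact ⟨u, D, hu, hD, hd, heq⟩
  refine ⟨Module.Finite.span_of_finite _ (Set.finite_range _), ?_, ?_, ?_, ?_⟩
  · rw [finrank_span_eq_card (linearIndependent_standardForm h), Fintype.card_fin]
  · exact fun ω hω _ => isLogarithmic_of_mem_span (isLogarithmic_standardForm a) hω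
  · intro ω hω h0 x
    obtain ⟨u, D, hu, hD, -, rfl⟩ := key ω hω h0
    rw [ordAt_C_div x u hu hD]
    omega
  · intro ω hω h0
    obtain ⟨u, D, hu, hD, hd, rfl⟩ := key ω hω h0
    rw [ordInfty_C_div u hu hD, hd]

theorem poles_standard {a : Fin n → k} (h : LinearIndependent (ZMod p) a) :
    poles (Submodule.span (ZMod p) (Set.range (standardForm (p := p) a))) =
      (Submodule.span (ZMod p) (Set.range a) : Set k) \ {0} := by
  ext x
  constructor
  · rintro ⟨ω, hω, h0, hx⟩
    obtain ⟨e, rfl⟩ := (Submodule.mem_span_range_iff_exists_fun _).1 hω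
    obtain ⟨u, D, hu, hD, -, hroot, heq⟩ := exists_sum_smul_standardForm_eq h (e := e) (by
      rintro rfl; simp at h0)
    rw [heq, ordAt_C_div x u hu hD] at hx
    obtain ⟨ε, rfl, hε⟩ := (hroot x).1 ((rootMultiplicity_pos hD).1 (by omega))
    refine ⟨(mem_span_iff_comb a _).2 ⟨ε, rfl⟩, fun h0 => hε ?_⟩
    have : ε = 0 := comb_injective h (by rw [Set.mem_singleton_iff.1 h0]; simp [comb])
    simp [this]
  · rintro ⟨hx, hx0⟩
    obtain ⟨ε, rfl⟩ := (mem_span_iff_comb a _).1 hx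
    have hε : ε ≠ 0 := by
      rintro rfl
      exact hx0 (by simp [comb])
    obtain ⟨j, hj⟩ := Function.ne_iff.1 hε
    have he : (Pi.single j 1 : Fin n → ZMod p) ≠ 0 := by simp
    obtain ⟨u, D, hu, hD, -, hroot, heq⟩ := exists_sum_smul_standardForm_eq h he
    refine ⟨_, (Submodule.mem_span_range_iff_exists_fun _).2 ⟨Pi.single j 1, rfl⟩, ?_, ?_⟩
    · rw [heq]
      intro h0
      exact div_ne_zero (rat_ne_zero (C_ne_zero.2 hu)) (rat_ne_zero hD)
        (smul_dX_injective (k := k) (a₂ := 0) (by simpa using h0))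
    · rw [heq, ordAt_C_div _ u hu hD]
      have := (rootMultiplicity_pos hD).2 ((hroot (comb a ε)).2
        ⟨ε, rfl, by simpa [Pi.single_apply] using hj⟩)
      omega

/-- Apart from the dimension, the conditions concern single forms, so they pass to subspaces with
the same `N`. -/
theorem IsLSpace.of_le {N m m' : ℕ} {W W' : Submodule (ZMod p) (Form k)} (h : IsLSpace N m W)
    (hle : W' ≤ W) (hW' : Module.finrank (ZMod p) W' = m') : IsLSpace N m' W' where
  finite := by
    have := h.finite
    exact Submodule.finiteDimensional_of_le hle
  finrank_eq := hW'
  logarithmic ω hω := h.logarithmic ω (hle hω)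
  no_zero ω hω := h.no_zero ω (hle hω)
  ordInfty_eq ω hω := h.ordInfty_eq ω (hle hω)

end StandardForms

end LSpace

namespace LSpace

/-! ### The linear system equivalent to giving rise to a tuple. -/

section MooreDual

/-- The linear system characterizing the tuple `(-1) ^ j Δ_{n-1}(hat τ j) / Δ_n(τ)`. -/
def IsMooreDual (p : ℕ) {K : Type*} [Field K] {n : ℕ} (τ w : Fin n → K) : Prop :=
  ∀ i : Fin n, ∑ j, τ j ^ p ^ (i : ℕ) * w j = if (i : ℕ) + 1 = n then (-1) ^ (n - 1) else 0

theorem hat_eq_succAbove {R : Type*} {m : ℕ} (a : Fin (m + 1) → R) (i : Fin (m + 1)) :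
    hat a i = fun j : Fin m => a (i.succAbove j) := by
  funext j
  rw [hat]
  split_ifs with h
  · congr 1
    rw [Fin.succAbove_of_castSucc_lt _ _ (Fin.lt_def.2 h)]
    rfl
  · congr 1
    rw [Fin.succAbove_of_le_castSucc _ _ (Fin.le_def.2 (not_lt.1 h))]
    rfl

/-- The last column of `M * adjugate M = det M`; the minors there omit the highest power, so they
are Moore determinants of the shortened tuples. -/
theorem sum_pow_mul_moore_hat {R : Type*} [CommRing R] (p : ℕ) {n : ℕ} (a : Fin n → R)
    (i : Fin n) :
    ∑ j, a j ^ p ^ (i : ℕ) * ((-1) ^ (j : ℕ) * moore p (hat a j)) =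
      if (i : ℕ) + 1 = n then (-1) ^ (n - 1) * moore p a else 0 := by
  obtain _ | m := n
  · exact i.elim0
  set M := Matrix.of fun i j : Fin (m + 1) => a j ^ p ^ (i : ℕ) with hM
  have h1 := congrFun (congrFun (Matrix.mul_adjugate M) i) (Fin.last m)
  simp only [Matrix.mul_apply, Matrix.adjugate_fin_succ_eq_det_submatrix, Matrix.smul_apply,
    Fin.succAbove_last, Matrix.one_apply, smul_eq_mul] at h1
  have h2 (j : Fin (m + 1)) : (M.submatrix Fin.castSucc j.succAbove).det = moore p (hat a j) := by
    rw [hat_eq_succAbove]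
    rfl
  simp only [h2, Fin.val_last] at h1
  have hsq : ((-1 : R) ^ m) * (-1) ^ m = 1 := by rw [← mul_pow]; simp
  have h3 := congrArg ((-1) ^ m * ·) h1
  simp only [Finset.mul_sum] at h3
  trans (-1) ^ m * (M.det * if i = Fin.last m then 1 else 0)
  · rw [← h3]
    refine Finset.sum_congr rfl fun j _ => ?_
    rw [pow_add, hM, Matrix.of_apply]
    linear_combination (-(a j ^ p ^ (i : ℕ) * (-1) ^ (j : ℕ) * moore p (hat a j))) * hsq
  · have hM' : M.det = moore p a := rfl
    have hi : (i = Fin.last m) ↔ ((i : ℕ) + 1 = m + 1) := by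
      rw [Fin.ext_iff, Fin.val_last]; omega
    simp only [hi, hM', Nat.add_sub_cancel]
    split_ifs <;> simp

theorem isMooreDual_iff {p : ℕ} {K : Type*} [Field K] {n : ℕ} {τ w : Fin n → K}
    (hτ : moore p τ ≠ 0) :
    IsMooreDual p τ w ↔ ∀ j, w j = (-1) ^ (j : ℕ) * moore p (hat τ j) / moore p τ := by
  have hsol : IsMooreDual p τ fun j => (-1) ^ (j : ℕ) * moore p (hat τ j) / moore p τ := by
    intro i
    simp only [← mul_div_assoc]
    rw [← Finset.sum_div, sum_pow_mul_moore_hat]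
    split_ifs
    · rw [mul_div_cancel_right₀ _ hτ]
    · exact zero_div _
  constructor
  · intro h
    set z : Fin n → K := fun j => (-1) ^ (j : ℕ) * moore p (hat τ j) / moore p τ
    have hz : Matrix.mulVec (Matrix.of fun i j : Fin n => τ j ^ p ^ (i : ℕ)) (w - z) = 0 := by
      ext i
      have h1 := (h i).trans (hsol i).symm
      simp only [Matrix.mulVec, dotProduct, Matrix.of_apply, Pi.sub_apply, mul_sub,
        Finset.sum_sub_distrib, Pi.zero_apply]
      exact sub_eq_zero.2 h1
    have := Matrix.eq_zero_of_mulVec_eq_zero hτ hz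
    exact fun j => sub_eq_zero.1 (congrFun this j)
  · intro h
    rwa [← funext h] at hsol

variable {p : ℕ} [Fact p.Prime]

/-- The system is additive in `τ`. For the difference `D`, raising equation `n - 1 - s` to the power
`p ^ s` gives `∑ D_j ^ p ^ (n - 1) * w_j ^ p ^ s = 0` for all `s < n`, a linear system whose matrix
is the invertible Moore matrix of `w`. -/
theorem IsMooreDual.unique {K : Type*} [Field K] [Algebra (ZMod p) K] {n : ℕ}
    {τ τ' w : Fin n → K} (h : IsMooreDual p τ w) (h' : IsMooreDual p τ' w)
    (hw : LinearIndependent (ZMod p) w) : τ = τ' := by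
  have := charP_of_algebra_zmod p K
  have : ExpChar K p := .prime Fact.out
  have hD (i : Fin n) : ∑ j, (τ j - τ' j) ^ p ^ (i : ℕ) * w j = 0 := by
    simp only [sub_pow_expChar_pow, sub_mul, Finset.sum_sub_distrib]
    rw [h i, h' i, sub_self]
  have hz : Matrix.mulVec (Matrix.of fun i j : Fin n => w j ^ p ^ (i : ℕ))
      (fun j => (τ j - τ' j) ^ p ^ (n - 1)) = 0 := by
    ext s
    simp only [Matrix.mulVec, dotProduct, Matrix.of_apply, Pi.zero_apply]
    have hs : n - 1 - (s : ℕ) < n := by omega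
    have h1 := congrArg (· ^ p ^ (s : ℕ)) (hD ⟨n - 1 - s, hs⟩)
    simp only [sum_pow_char_pow] at h1
    rw [zero_pow (pow_ne_zero _ (Fact.out : p.Prime).ne_zero)] at h1
    rw [← h1]
    refine Finset.sum_congr rfl fun j _ => ?_
    rw [mul_pow, ← pow_mul, ← pow_add, mul_comm, show n - 1 - (s : ℕ) + s = n - 1 by omega]
  have hz' := Matrix.eq_zero_of_mulVec_eq_zero ((moore_ne_zero_iff w).2 hw) hz
  funext j
  exact sub_eq_zero.1 ((pow_eq_zero_iff (pow_ne_zero _ (Fact.out : p.Prime).ne_zero)).1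
    (congrFun hz' j))

/-- Applying to a tuple an additive polynomial that kills its first `r` entries. -/
theorem IsMooreDual.additive {K : Type*} [Field K] [Algebra (ZMod p) K] {r t : ℕ}
    {τ w : Fin (r + t) → K} (h : IsMooreDual p τ w) (lam : ℕ → K) (hlam : lam r = 1)
    (hker : ∀ i : Fin r, ∑ l ∈ Finset.range (r + 1), lam l * τ (Fin.castAdd t i) ^ p ^ l = 0) :
    IsMooreDual p
      (fun i : Fin t => (-1) ^ r * ∑ l ∈ Finset.range (r + 1), lam l * τ (Fin.natAdd r i) ^ p ^ l)
      (fun i => w (Fin.natAdd r i)) := by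
  have := charP_of_algebra_zmod p K
  have : ExpChar K p := .prime Fact.out
  intro i
  have hneg : ((-1 : K) ^ r) ^ p ^ (i : ℕ) = (-1) ^ r := by
    rw [← pow_mul, mul_comm, pow_mul, neg_one_pow_expChar_pow]
  have hsum : ∑ j : Fin (r + t),
      (∑ l ∈ Finset.range (r + 1), lam l * τ j ^ p ^ l) ^ p ^ (i : ℕ) * w j =
      if (i : ℕ) + 1 = t then (-1) ^ (r + t - 1) else 0 := by
    simp only [sum_pow_char_pow, Finset.sum_mul, mul_pow, ← pow_mul, ← pow_add, mul_assoc]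
    rw [Finset.sum_comm]
    simp only [← Finset.mul_sum]
    -- Since `l ≤ r` and `i < t`, the exponent `l + i` reaches `r + t - 1` only for `l = r` and `i =
    -- t - 1`; the coefficient there is `lam r = 1`.
    have hl (l) (hlr : l ∈ Finset.range (r + 1)) :
        lam l ^ p ^ (i : ℕ) * ∑ j, τ j ^ p ^ (l + (i : ℕ)) * w j =
        if l = r ∧ (i : ℕ) + 1 = t then (-1) ^ (r + t - 1) else 0 := by
      have hlr' := Finset.mem_range.1 hlr
      rw [h ⟨l + i, by omega⟩]
      by_cases hc : l = r ∧ (i : ℕ) + 1 = t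
      · rw [if_pos hc, if_pos (by simp only; omega), hc.1, hlam, one_pow, one_mul]
      · rw [if_neg hc, if_neg (by simp only; omega), mul_zero]
    rw [Finset.sum_congr rfl hl, Finset.sum_eq_single r]
    · simp
    · intro l _ hl
      rw [if_neg fun hc => hl hc.1]
    · simp
  rw [Fin.sum_univ_add] at hsum
  simp only [hker, zero_pow (pow_ne_zero _ (Fact.out : p.Prime).ne_zero), zero_mul,
    Finset.sum_const_zero, zero_add] at hsum
  simp only [mul_pow, hneg, mul_assoc, ← Finset.mul_sum]
  rw [hsum]
  split_ifs with hi
  · rw [← pow_add, show r + (r + t - 1) = 2 * r + (t - 1) by omega, pow_add, pow_mul]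
    simp
  · exact mul_zero _

end MooreDual

/-! ### Tuples of polynomials giving rise to the standard forms. -/

section GivesRise

variable {p : ℕ} {k : Type*} [Field k] {n : ℕ}

theorem moore_rat (T : Fin n → k[X]) : moore p (fun j => rat (T j)) = rat (moore p T) := by
  rw [moore, moore, rat, RingHom.map_det]
  congr 1
  ext i j
  simp

theorem hat_rat (T : Fin n → k[X]) (i : Fin n) :
    hat (fun j => rat (T j)) i = fun j => rat (hat T i j) := by
  funext j
  simp only [hat]
  split_ifs <;> rfl

theorem natDegree_standardPoly {μ : k} (hμ : μ ≠ 0) (a : Fin n → k) {i : Fin n} (ha : a i ≠ 0) :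
    (standardPoly p μ a i).natDegree = p - 1 := by
  rw [standardPoly, natDegree_C_mul hμ, natDegree_sub_C, natDegree_C_mul_X_pow _ _ ha]

theorem leadingCoeff_standardPoly [Fact p.Prime] {μ : k} (hμ : μ ≠ 0) (a : Fin n → k) {i : Fin n}
    (ha : a i ≠ 0) : (standardPoly p μ a i).leadingCoeff = μ * a i := by
  have hp : 1 < p := (Fact.out : p.Prime).one_lt
  rw [leadingCoeff, natDegree_standardPoly hμ a ha, standardPoly, coeff_C_mul, coeff_sub,
    coeff_C_mul_X_pow, if_pos rfl, coeff_C, if_neg (by omega), sub_zero]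

variable [Fact p.Prime] [Algebra (ZMod p) k]

/-- A relation among the `T i` is one among their coefficients of degree `d`. -/
theorem moore_ne_zero_of_leadingCoeff {T : Fin n → k[X]} {d : ℕ} (hd : ∀ i, (T i).natDegree = d)
    (hT : moore p (fun i => (T i).leadingCoeff) ≠ 0) : moore p T ≠ 0 := by
  rw [moore_ne_zero_iff, Fintype.linearIndependent_iff] at hT ⊢
  intro e he
  refine hT e ?_
  have := congrArg (Polynomial.coeff · d) he
  simpa [finsetSum_coeff, leadingCoeff, hd] using this

theorem givesRiseTo_iff {d : ℕ} {T : Fin n → k[X]} {ω : Fin n → Form k} (hd : 1 ≤ d)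
    (hT : ∀ i, (T i).natDegree = d) (hlc : moore p (fun i => (T i).leadingCoeff) ≠ 0) :
    GivesRiseTo p d T ω ↔ IsMooreDual p (fun j => rat (T j)) (fun j => coeff (ω j)) := by
  have h0 : moore p (fun j => rat (T j)) ≠ 0 := by
    rw [moore_rat]
    exact rat_ne_zero (moore_ne_zero_of_leadingCoeff hT hlc)
  have heq (j : Fin n) : rat ((-1) ^ (j : ℕ) * moore p (hat T j)) / rat (moore p T) =
      (-1) ^ (j : ℕ) * moore p (hat (fun j => rat (T j)) j) / moore p (fun j => rat (T j)) := by
    rw [hat_rat, moore_rat, moore_rat, rat, map_mul, map_pow, map_neg, map_one]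
  rw [isMooreDual_iff h0]
  constructor
  · rintro ⟨-, -, -, h⟩ j
    rw [h j, coeff_smul_dX, heq]
  · intro h
    refine ⟨hd, hT, hlc, fun j => ?_⟩
    rw [heq, ← h j, coeff_smul_dX']

theorem GivesRiseTo.isMooreDual {d : ℕ} {T : Fin n → k[X]} {ω : Fin n → Form k}
    (h : GivesRiseTo p d T ω) :
    IsMooreDual p (fun j => rat (T j)) (fun j => coeff (ω j)) :=
  (givesRiseTo_iff h.one_le h.natDegree_eq h.moore_leadingCoeff).1 h

theorem linearIndependent_coeff {ω : Fin n → Form k} (hω : LinearIndependent (ZMod p) ω) :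
    LinearIndependent (ZMod p) fun j => coeff (ω j) :=
  hω.map' (ofCoeff.symm.toLinearMap.restrictScalars (ZMod p))
    (LinearMap.ker_eq_bot.2 ofCoeff.symm.injective)

theorem eq_of_isMooreDual {T T' : Fin n → k[X]} {ω : Fin n → Form k}
    (hω : LinearIndependent (ZMod p) ω)
    (h : IsMooreDual p (fun j => rat (T j)) (fun j => coeff (ω j)))
    (h' : IsMooreDual p (fun j => rat (T' j)) (fun j => coeff (ω j))) : T = T' :=
  funext fun j => RatFunc.algebraMap_injective k
    (congrFun (h.unique h' (linearIndependent_coeff hω)) j)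

theorem GivesRiseTo.iff_eq {d : ℕ} {T : Fin n → k[X]} {ω : Fin n → Form k}
    (hω : LinearIndependent (ZMod p) ω) (h : GivesRiseTo p d T ω) (T' : Fin n → k[X]) :
    GivesRiseTo p d T' ω ↔ T' = T :=
  ⟨fun h' => eq_of_isMooreDual hω h'.isMooreDual h.isMooreDual, fun h' => h' ▸ h⟩

theorem moore_const_mul_ne_zero {a : Fin n → k} (h : LinearIndependent (ZMod p) a) {c : k}
    (hc : c ≠ 0) : moore p (fun i => c * a i) ≠ 0 := by
  rw [moore_ne_zero_iff]
  rw [Fintype.linearIndependent_iff] at h ⊢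
  intro e he
  refine h e ?_
  simp_rw [← mul_smul_comm] at he
  rw [← Finset.mul_sum] at he
  exact (mul_eq_zero.1 he).resolve_left hc

theorem sum_pow_mul_coeff_standardForm (a : Fin n → k) (i : ℕ) :
    ∑ j, RatFunc.C (a j ^ p ^ i) * coeff (standardForm (p := p) a j) =
      ∑ ε : Fin n → ZMod p, RatFunc.C (comb a ε ^ p ^ i) /
        (RatFunc.X - RatFunc.C (comb a ε)) := by
  simp only [standardForm, coeff_smul_dX, Finset.mul_sum]
  rw [Finset.sum_comm]
  refine Finset.sum_congr rfl fun ε _ => ?_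
  rw [comb, sum_smul_pow, map_sum RatFunc.C (fun j => ε j • a j ^ p ^ i), Finset.sum_div]
  refine Finset.sum_congr rfl fun j _ => ?_
  rw [Algebra.smul_def, map_mul, ← mul_div_assoc, mul_comm]

theorem sum_pow_mul_coeff_standardForm_of_lt {a : Fin n → k} (h : LinearIndependent (ZMod p) a)
    {i : ℕ} (hi : i < n) :
    ∑ j, RatFunc.C (a j ^ p ^ i) * coeff (standardForm (p := p) a j) =
      RatFunc.C (mooreConst p a) * RatFunc.X ^ p ^ i /
        rat (structuralPoly (Submodule.span (ZMod p) (Set.range a))) := by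
  have hL : (X ^ p ^ i : k[X]).degree < (p ^ n : ℕ) := by
    rw [degree_X_pow]
    exact_mod_cast Nat.pow_lt_pow_right (Fact.out : p.Prime).one_lt hi
  have := sum_eval_div_X_sub_C h hL
  simp only [eval_pow, eval_X] at this
  rw [sum_pow_mul_coeff_standardForm, this, rat, map_mul, map_pow, RatFunc.algebraMap_C,
    RatFunc.algebraMap_X]

/-- `X ^ p ^ n` has too large a degree for the partial fraction formula; subtracting the structural
polynomial lowers the degree and keeps the values on the span. -/
theorem sum_pow_mul_coeff_standardForm_self {a : Fin n → k} (h : LinearIndependent (ZMod p) a) :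
    ∑ j, RatFunc.C (a j ^ p ^ n) * coeff (standardForm (p := p) a j) =
      RatFunc.C (mooreConst p a) * (RatFunc.X ^ p ^ n -
          rat (structuralPoly (Submodule.span (ZMod p) (Set.range a)))) /
        rat (structuralPoly (Submodule.span (ZMod p) (Set.range a))) := by
  set P := structuralPoly (Submodule.span (ZMod p) (Set.range a)) with hP
  have hPm : P.Monic := structuralPoly_monic h
  have hPd : P.natDegree = p ^ n := structuralPoly_natDegree h
  have hL : (X ^ p ^ n - P : k[X]).degree < (p ^ n : ℕ) := by
    have h1 : (X ^ p ^ n : k[X]).degree = (p ^ n : ℕ) := degree_X_pow _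
    rw [← h1]
    refine degree_sub_lt_left ?_ (pow_ne_zero _ X_ne_zero) ?_
    · rw [h1, degree_eq_natDegree hPm.ne_zero, hPd]
    · rw [hPm, (monic_X_pow _).leadingCoeff]
  have := sum_eval_div_X_sub_C h hL
  simp only [eval_sub, eval_pow, eval_X, hP, structuralPoly_eval_comb h, sub_zero] at this
  rw [← hP] at this
  rw [sum_pow_mul_coeff_standardForm, this, rat, map_mul, map_sub, map_pow, RatFunc.algebraMap_C,
    RatFunc.algebraMap_X]

/-- Row `i` is `μ ^ p ^ i` times `X ^ ((p - 1) p ^ i) * s_i - s_{i+1}`, where `s_i = ∑ a_j ^ p ^ i *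
w_j` and `w_j` is the coefficient of the `j`-th form. As `s_i = c X ^ p ^ i / P` for `i < n`, the
difference vanishes except in the last row, where the correction in `s_n` leaves `c`. -/
theorem isMooreDual_standard {a : Fin n → k} (h : LinearIndependent (ZMod p) a)
    {μ : k} (hμ : μ ^ p ^ (n - 1) = -1 / moore p a ^ (p - 1)) :
    IsMooreDual p (fun j => rat (standardPoly p μ a j))
      (fun j => coeff (standardForm (p := p) a j)) := by
  have hp : 1 < p := (Fact.out : p.Prime).one_lt
  have := charP_of_algebra_zmod p (RatFunc k)
  have : ExpChar (RatFunc k) p := .prime Fact.out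
  intro i
  set P := structuralPoly (Submodule.span (ZMod p) (Set.range a)) with hP
  have hP0 : rat P ≠ 0 := rat_ne_zero (structuralPoly_monic h).ne_zero
  have hexp : ∑ j, rat (standardPoly p μ a j) ^ p ^ (i : ℕ) * coeff (standardForm (p := p) a j) =
      RatFunc.C (μ ^ p ^ (i : ℕ)) * (RatFunc.X ^ ((p - 1) * p ^ (i : ℕ)) *
        (∑ j, RatFunc.C (a j ^ p ^ (i : ℕ)) * coeff (standardForm (p := p) a j)) -
        ∑ j, RatFunc.C (a j ^ p ^ ((i : ℕ) + 1)) * coeff (standardForm (p := p) a j)) := by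
    rw [Finset.mul_sum, ← Finset.sum_sub_distrib, Finset.mul_sum]
    refine Finset.sum_congr rfl fun j _ => ?_
    rw [standardPoly, rat, map_mul, map_sub, map_mul, map_pow, RatFunc.algebraMap_C,
      RatFunc.algebraMap_C, RatFunc.algebraMap_C, RatFunc.algebraMap_X, mul_pow,
      sub_pow_expChar_pow, mul_pow, ← map_pow, ← map_pow, ← map_pow, ← pow_mul, ← pow_mul,
      ← pow_succ']
    ring
  have hX : (RatFunc.X ^ ((p - 1) * p ^ (i : ℕ)) * RatFunc.X ^ p ^ (i : ℕ) : RatFunc k) =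
      RatFunc.X ^ p ^ ((i : ℕ) + 1) := by
    rw [← pow_add, ← Nat.succ_mul, pow_succ', show (p - 1).succ = p by omega]
  rw [hexp, sum_pow_mul_coeff_standardForm_of_lt h i.2, ← hP]
  split_ifs with hi
  · have hself := sum_pow_mul_coeff_standardForm_self h
    rw [← hP] at hself
    have hpow : p ^ ((i : ℕ) + 1) = p ^ n := by rw [hi]
    have hin : (i : ℕ) = n - 1 := by omega
    -- The normalisation of `μ` is what turns the last row into the required sign.
    have hc : μ ^ p ^ (i : ℕ) * mooreConst p a = (-1) ^ (n - 1) := by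
      have hm : moore p a ^ (p - 1) ≠ 0 := pow_ne_zero _ ((moore_ne_zero_iff a).2 h)
      have hsgn : ((-1 : k)) ^ n = (-1) ^ (n - 1) * -1 := by rw [← pow_succ, ← hin, hi]
      rw [hin, hμ, mooreConst, hsgn]
      field_simp
    have hc' := congrArg (RatFunc.C (K := k)) hc
    rw [map_mul, map_pow (RatFunc.C (K := k)) (-1), map_neg, map_one] at hc'
    rw [hpow, hself, ← hc', ← mul_div_assoc, mul_left_comm, hX, hpow]
    field_simp
    rw [sub_sub_cancel]
  · rw [sum_pow_mul_coeff_standardForm_of_lt h (by omega : (i : ℕ) + 1 < n), ← hP,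
      ← mul_div_assoc, mul_left_comm, hX, sub_self, mul_zero]

theorem constant_ne_zero {a : Fin n → k} (h : LinearIndependent (ZMod p) a)
    {μ : k} (hμ : μ ^ p ^ (n - 1) = -1 / moore p a ^ (p - 1)) : μ ≠ 0 := by
  rintro rfl
  rw [zero_pow (pow_ne_zero _ (Fact.out : p.Prime).ne_zero)] at hμ
  exact div_ne_zero (neg_ne_zero.2 one_ne_zero)
    (pow_ne_zero _ ((moore_ne_zero_iff a).2 h)) hμ.symm

theorem moore_leadingCoeff_standardPoly {a : Fin n → k} (h : LinearIndependent (ZMod p) a)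
    {μ : k} (hμ : μ ≠ 0) :
    moore p (fun i => (standardPoly p μ a i).leadingCoeff) ≠ 0 := by
  simp only [fun i => leadingCoeff_standardPoly (p := p) hμ a (h.ne_zero i)]
  exact moore_const_mul_ne_zero h hμ

theorem givesRiseTo_standard {a : Fin n → k} (h : LinearIndependent (ZMod p) a)
    {μ : k} (hμ : μ ^ p ^ (n - 1) = -1 / moore p a ^ (p - 1)) :
    GivesRiseTo p (p - 1) (standardPoly p μ a) (standardForm (p := p) a) := by
  have hp : 1 < p := (Fact.out : p.Prime).one_lt
  have hμ0 := constant_ne_zero h hμ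
  exact (givesRiseTo_iff (by omega) (fun i => natDegree_standardPoly hμ0 a (h.ne_zero i))
    (moore_leadingCoeff_standardPoly h hμ0)).2 (isMooreDual_standard h hμ)

end GivesRise

end LSpace

namespace LSpace

/-! ### Substitution of a nonconstant polynomial and pullback of forms. -/

section Pullback

variable {k : Type*} [Field k]

theorem eval₂_C_rat (S P : k[X]) : P.eval₂ RatFunc.C (rat S) = rat (P.comp S) := by
  rw [comp, rat, rat, hom_eval₂]
  congr 1

theorem comp_ne_zero {S P : k[X]} (hS : S.natDegree ≠ 0) (hP : P ≠ 0) : P.comp S ≠ 0 := by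
  intro h
  rcases comp_eq_zero_iff.1 h with h | h
  · exact hP h
  · exact hS (by rw [h.2, natDegree_C])

theorem eval₂_denom_ne_zero {S : k[X]} (hS : S.natDegree ≠ 0) (f : RatFunc k) :
    f.denom.eval₂ RatFunc.C (rat S) ≠ 0 := by
  rw [eval₂_C_rat]
  exact rat_ne_zero (comp_ne_zero hS f.denom_ne_zero)

/-- The substitution `f(X) ↦ f(S(X))` for a nonconstant polynomial `S`. -/
noncomputable def subst (S : k[X]) (hS : S.natDegree ≠ 0) : RatFunc k →+* RatFunc k where
  toFun := RatFunc.eval RatFunc.C (rat S)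
  map_one' := RatFunc.eval_one _ _
  map_zero' := RatFunc.eval_zero _ _
  map_mul' _ _ := RatFunc.eval_mul _ _ (eval₂_denom_ne_zero hS _) (eval₂_denom_ne_zero hS _)
  map_add' _ _ := RatFunc.eval_add _ _ (eval₂_denom_ne_zero hS _) (eval₂_denom_ne_zero hS _)

theorem subst_rat (S : k[X]) (hS : S.natDegree ≠ 0) (P : k[X]) :
    subst S hS (rat P) = rat (P.comp S) := by
  rw [← eval₂_C_rat]
  exact RatFunc.eval_algebraMap _ _ P

theorem dd_rat (S : k[X]) : dd (rat S) = rat (derivative S) • dd RatFunc.X := by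
  rw [rat, rat, ← RatFunc.aeval_X_left_eq_algebraMap, ← RatFunc.aeval_X_left_eq_algebraMap, dd,
    Derivation.map_aeval]

theorem pullback_eq (S : k[X]) (hS : S.natDegree ≠ 0) (ω : Form k) :
    pullback S ω = (subst S hS (coeff ω) * rat (derivative S)) • dd RatFunc.X := by
  rw [pullback, dd_rat, smul_smul]
  rfl

theorem pullback_smul_dX (S : k[X]) (hS : S.natDegree ≠ 0) (P Q : k[X]) :
    pullback S ((rat P / rat Q) • dd RatFunc.X) =
      (rat (P.comp S * derivative S) / rat (Q.comp S)) • dd RatFunc.X := by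
  rw [pullback_eq S hS, coeff_smul_dX, map_div₀, subst_rat, subst_rat, rat, rat, rat, rat, map_mul,
    mul_div_right_comm]

/-- Pullback of forms as an `𝔽_p`-linear map. -/
noncomputable def pullbackLinear (p : ℕ) [Algebra (ZMod p) k] (S : k[X]) (hS : S.natDegree ≠ 0) :
    Form k →ₗ[ZMod p] Form k :=
  AddMonoidHom.toZModLinearMap p
    { toFun := pullback S
      map_zero' := by simp [pullback_eq S hS, coeff]
      map_add' := fun ω ω' => by
        simp only [pullback_eq S hS, coeff_add, map_add, add_mul, add_smul] }

end Pullback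

/-! ### Passing to the quotient by the span of the first `r` entries. -/

section Quotient

variable {p : ℕ} [Fact p.Prime] {k : Type*} [Field k] [Algebra (ZMod p) k] {r t : ℕ}

theorem comb_add {R : Type*} [CommRing R] [Algebra (ZMod p) R] (a : Fin (r + t) → R)
    (e : Fin (r + t) → ZMod p) :
    comb a e = comb (fun i => a (Fin.castAdd t i)) (fun i => e (Fin.castAdd t i)) +
      comb (fun i => a (Fin.natAdd r i)) (fun i => e (Fin.natAdd r i)) := by
  simp only [comb, Fin.sum_univ_add]

theorem linearIndependent_castAdd {M : Type*} [AddCommMonoid M] [Module (ZMod p) M]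
    {a : Fin (r + t) → M} (h : LinearIndependent (ZMod p) a) :
    LinearIndependent (ZMod p) fun i : Fin r => a (Fin.castAdd t i) :=
  h.comp _ (Fin.castAdd_injective r t)

theorem linearIndependent_natAdd {M : Type*} [AddCommMonoid M] [Module (ZMod p) M]
    {a : Fin (r + t) → M} (h : LinearIndependent (ZMod p) a) :
    LinearIndependent (ZMod p) fun i : Fin t => a (Fin.natAdd r i) :=
  h.comp _ (Fin.natAdd_injective t r)

/-- The structural polynomial of the span of the first `r` entries of `a`. -/
@[irreducible]
noncomputable def headPoly (p : ℕ) [Fact p.Prime] [Algebra (ZMod p) k] (a : Fin (r + t) → k) : k[X] :=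
  structuralPoly (Submodule.span (ZMod p) (Set.range fun i : Fin r => a (Fin.castAdd t i)))

/-- The images of the last `t` entries of `a` under the structural polynomial of the span of the
first `r` entries. -/
@[irreducible]
noncomputable def tailImage (p : ℕ) [Fact p.Prime] [Algebra (ZMod p) k] (a : Fin (r + t) → k) : Fin t → k :=
  fun i => (headPoly p a).eval (a (Fin.natAdd r i))

theorem headPoly_def (a : Fin (r + t) → k) : headPoly p a =
    structuralPoly (Submodule.span (ZMod p) (Set.range fun i : Fin r => a (Fin.castAdd t i))) := by
  rw [headPoly]

theorem tailImage_def (a : Fin (r + t) → k) : tailImage p a =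
    fun i => (headPoly p a).eval (a (Fin.natAdd r i)) := by
  unfold tailImage
  rfl

theorem headPoly_natDegree {a : Fin (r + t) → k} (h : LinearIndependent (ZMod p) a) :
    (headPoly p a).natDegree = p ^ r := by
  rw [headPoly_def, structuralPoly_natDegree (linearIndependent_castAdd h)]

theorem headPoly_monic {a : Fin (r + t) → k} (h : LinearIndependent (ZMod p) a) :
    (headPoly p a).Monic := by
  rw [headPoly_def]
  exact structuralPoly_monic (linearIndependent_castAdd h)

theorem headPoly_derivative {a : Fin (r + t) → k} (h : LinearIndependent (ZMod p) a) :
    derivative (headPoly p a) = C (mooreConst p (fun i : Fin r => a (Fin.castAdd t i))) := by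
  rw [headPoly_def, structuralPoly_derivative (linearIndependent_castAdd h), mooreConst]

theorem headPoly_natDegree_ne_zero {a : Fin (r + t) → k} (h : LinearIndependent (ZMod p) a) :
    (headPoly p a).natDegree ≠ 0 := by
  rw [headPoly_natDegree h]
  exact pow_ne_zero _ (Fact.out : p.Prime).ne_zero

theorem headPoly_eval_comb {a : Fin (r + t) → k} (h : LinearIndependent (ZMod p) a)
    (e : Fin (r + t) → ZMod p) :
    (headPoly p a).eval (comb a e) =
      comb (tailImage p a) (fun i => e (Fin.natAdd r i)) := by
  have h1 := linearIndependent_castAdd h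
  rw [tailImage_def, headPoly_def, comb, structuralPoly_eval_comb_smul h1, Fin.sum_univ_add, comb]
  simp only [add_eq_right]
  refine Finset.sum_eq_zero fun i _ => ?_
  have := structuralPoly_eval_comb h1 (Pi.single i 1)
  rw [comb, Finset.sum_eq_single i (fun j _ hj => by simp [hj]) (by simp)] at this
  simp only [Pi.single_eq_same, one_smul] at this
  rw [this, smul_zero]

/-- A combination of the last entries killed by `headPoly` is a root of it, hence lies in the span
of the first `r` entries; independence of `a` makes it trivial. -/
theorem linearIndependent_tailImage {a : Fin (r + t) → k} (h : LinearIndependent (ZMod p) a) :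
    LinearIndependent (ZMod p) (tailImage p a) := by
  rw [Fintype.linearIndependent_iff]
  intro e he i
  have h1 := headPoly_eval_comb h (Fin.append 0 e)
  simp only [Fin.append_right] at h1
  have h0 : comb (tailImage p a) e = 0 := he
  rw [h0, headPoly_def] at h1
  obtain ⟨ε, hε⟩ := structuralPoly_eval_eq_zero (linearIndependent_castAdd h) h1
  have h2 : comb a (Fin.append ε 0) = comb a (Fin.append 0 e) := by
    rw [comb_add]
    simp only [Fin.append_left, Fin.append_right]
    rw [hε]
    simp [comb]
  have := congrFun (comb_injective h h2) (Fin.natAdd r i)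
  simpa using this.symm

theorem structuralPoly_comp_headPoly {a : Fin (r + t) → k} (h : LinearIndependent (ZMod p) a) :
    structuralPoly (Submodule.span (ZMod p) (Set.range a)) =
      (structuralPoly (Submodule.span (ZMod p) (Set.range (tailImage p a)))).comp
        (headPoly p a) := by
  have hb := linearIndependent_tailImage h
  have hm := (structuralPoly_monic hb).comp (headPoly_monic h)
    (headPoly_natDegree_ne_zero h)
  have hd : ((structuralPoly (Submodule.span (ZMod p) (Set.range (tailImage p a)))).comp
      (headPoly p a)).natDegree = p ^ (r + t) := by
    rw [natDegree_comp, structuralPoly_natDegree hb, headPoly_natDegree h, ← pow_add, add_comm]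
  have := eq_C_mul_structuralPoly h hd.le fun e => by
    rw [eval_comp, headPoly_eval_comb h, structuralPoly_eval_comb hb]
  rw [this]
  rw [← hd, coeff_natDegree, hm, C_1, one_mul]

/-- The chain rule for the composition above, all derivatives being constant. -/
theorem mooreConst_mul {a : Fin (r + t) → k} (h : LinearIndependent (ZMod p) a) :
    mooreConst p a = mooreConst p (tailImage p a) *
      mooreConst p (fun i : Fin r => a (Fin.castAdd t i)) := by
  have h1 := congrArg derivative (structuralPoly_comp_headPoly h)
  rw [derivative_comp, structuralPoly_derivative h,
    structuralPoly_derivative (linearIndependent_tailImage h),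
    headPoly_derivative h, C_comp, ← C_mul,
    ← mooreConst, ← mooreConst] at h1
  rw [mul_comm]
  exact C_injective h1

/-- If `L` is the additive polynomial dual to entry `i` of `tailImage`, then `L ∘ headPoly` is the
one dual to entry `r + i` of `a`. Both forms become `c (L ∘ S) / P`, the factor `S'` of the pullback
being absorbed by `mooreConst_mul`. -/
theorem pullback_standardForm {a : Fin (r + t) → k} (h : LinearIndependent (ZMod p) a)
    (i : Fin t) :
    standardForm (p := p) a (Fin.natAdd r i) =
      pullback (headPoly p a) (standardForm (p := p) (tailImage p a) i) := by
  have hb := linearIndependent_tailImage h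
  have hS := headPoly_natDegree_ne_zero h
  obtain ⟨lam, hlam⟩ := exists_interpolating_additive hb (Pi.single i 1)
  have hLdeg := degree_additive_lt (p := p) lam
  set L : k[X] := ∑ i : Fin t, C (lam i) * X ^ p ^ (i : ℕ)
  have hform := sum_smul_standardForm_eq hb hLdeg _ hlam
  rw [Finset.sum_eq_single i (fun j _ hj => by simp [hj]) (by simp), Pi.single_eq_same,
    one_smul] at hform
  have hcomp : (L.comp (headPoly p a)).degree < (p ^ (r + t) : ℕ) := by
    rcases eq_or_ne L 0 with h0 | h0
    · rw [h0, zero_comp, degree_zero]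
      exact WithBot.bot_lt_coe _
    · rw [← natDegree_lt_iff_degree_lt (comp_ne_zero hS h0), natDegree_comp, headPoly_natDegree h,
        add_comm r t, pow_add]
      exact Nat.mul_lt_mul_of_pos_right ((natDegree_lt_iff_degree_lt h0).2 hLdeg)
        (pow_pos (Fact.out : p.Prime).pos _)
  have hform' := sum_smul_standardForm_eq h hcomp (Pi.single (Fin.natAdd r i) 1) fun ε => by
    rw [eval_comp, headPoly_eval_comb h, hlam]
    simp [Pi.single_apply]
  rw [Finset.sum_eq_single (Fin.natAdd r i) (fun j _ hj => by simp [hj]) (by simp),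
    Pi.single_eq_same, one_smul] at hform'
  rw [hform, hform', pullback_smul_dX _ hS, structuralPoly_comp_headPoly h, mooreConst_mul h,
    headPoly_derivative h, mul_comp, C_comp, C_mul]
  congr 3
  ring

theorem leadingCoeff_pulled {a : Fin (r + t) → k} (h : LinearIndependent (ZMod p) a)
    {μ' η : k} (hμ' : μ' ≠ 0) (i : Fin t) :
    (C η * (standardPoly p μ' (tailImage p a) i).comp (headPoly p a)).leadingCoeff =
      η * μ' * tailImage p a i := by
  rw [leadingCoeff_mul, leadingCoeff_C, leadingCoeff_comp (headPoly_natDegree_ne_zero h),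
    leadingCoeff_standardPoly hμ' _ ((linearIndependent_tailImage h).ne_zero i),
    headPoly_monic h, one_pow, mul_one, mul_assoc]

/-- Substituting `S` in the system of the small tuple and scaling by `η` multiplies row `i` by `η ^
p ^ i * S'`. Only the row `i = t - 1` has a nonzero right side, and there this factor is `1`. -/
theorem givesRiseTo_pullback {a : Fin (r + t) → k} (h : LinearIndependent (ZMod p) a)
    {μ' η : k} (hμ' : μ' ^ p ^ (t - 1) = -1 / moore p (tailImage p a) ^ (p - 1))
    (hη : η ^ p ^ (t - 1) =
      (-1) ^ r / moore p (fun i : Fin r => a (Fin.castAdd t i)) ^ (p - 1)) :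
    GivesRiseTo p ((p - 1) * p ^ r)
      (fun i => C η * (standardPoly p μ' (tailImage p a) i).comp (headPoly p a))
      (fun i => pullback (headPoly p a)
        (standardForm (p := p) (tailImage p a) i)) := by
  have hp : 1 < p := (Fact.out : p.Prime).one_lt
  have hb := linearIndependent_tailImage h
  have hS := headPoly_natDegree_ne_zero h
  have hμ0 := constant_ne_zero hb hμ'
  have ha1 := linearIndependent_castAdd h
  have hm : moore p (fun i : Fin r => a (Fin.castAdd t i)) ^ (p - 1) ≠ 0 :=
    pow_ne_zero _ ((moore_ne_zero_iff _).2 ha1)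
  have hη0 : η ≠ 0 := by
    rintro rfl
    rw [zero_pow (pow_ne_zero _ (by omega))] at hη
    exact div_ne_zero (pow_ne_zero _ (neg_ne_zero.2 one_ne_zero)) hm hη.symm
  have hηc : η ^ p ^ (t - 1) * mooreConst p (fun i : Fin r => a (Fin.castAdd t i)) = 1 := by
    rw [hη, mooreConst, div_mul_eq_mul_div, ← mul_assoc, ← mul_pow]
    simp [hm]
  refine (givesRiseTo_iff ?_ ?_ ?_).2 ?_
  · have : 0 < (p - 1) * p ^ r := Nat.mul_pos (by omega) (pow_pos (by omega) _)
    omega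
  · intro i
    rw [natDegree_C_mul hη0, natDegree_comp, natDegree_standardPoly hμ0 _ (hb.ne_zero i),
      headPoly_natDegree h]
  · simp only [leadingCoeff_pulled h hμ0]
    exact moore_const_mul_ne_zero hb (mul_ne_zero hη0 hμ0)
  · intro i
    have h1 := congrArg (subst _ hS) (isMooreDual_standard hb hμ' i)
    simp only [map_sum, map_mul, map_pow, subst_rat] at h1
    have h2 (j : Fin t) : rat (C η * (standardPoly p μ' (tailImage p a) j).comp
          (headPoly p a)) ^ p ^ (i : ℕ) *
        coeff (pullback (headPoly p a)
          (standardForm (p := p) (tailImage p a) j)) =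
        RatFunc.C (η ^ p ^ (i : ℕ) * mooreConst p (fun i : Fin r => a (Fin.castAdd t i))) *
        (rat ((standardPoly p μ' (tailImage p a) j).comp (headPoly p a)) ^
          p ^ (i : ℕ) * subst _ hS (coeff (standardForm (p := p) (tailImage p a) j))) := by
      rw [pullback_eq _ hS, coeff_smul_dX, headPoly_derivative h, rat, rat,
        rat, map_mul, mul_pow, RatFunc.algebraMap_C, RatFunc.algebraMap_C, map_mul, map_pow]
      ring
    simp only [h2]
    rw [← Finset.mul_sum, h1]
    split_ifs with hi
    · rw [show (i : ℕ) = t - 1 by omega, hηc]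
      simp
    · simp

/-- Both sides, divided by `(-1) ^ r`, solve the system of the last `t` standard forms: one by
pullback, the other by `IsMooreDual.additive`. These forms are independent, so the solutions agree.
-/
theorem pulled_eq_structuralPoly_eval {a : Fin (r + t) → k}
    (h : LinearIndependent (ZMod p) a)
    {μ μ' η : k} (hμ : μ ^ p ^ (r + t - 1) = -1 / moore p a ^ (p - 1))
    (hμ' : μ' ^ p ^ (t - 1) = -1 / moore p (tailImage p a) ^ (p - 1))
    (hη : η ^ p ^ (t - 1) =
      (-1) ^ r / moore p (fun i : Fin r => a (Fin.castAdd t i)) ^ (p - 1)) (i : Fin t) :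
    (-1) ^ r * (C η * (standardPoly p μ' (tailImage p a) i).comp (headPoly p a)) =
      (structuralPoly (Submodule.span (ZMod p)
        (Set.range fun j : Fin r => standardPoly p μ a (Fin.castAdd t j)))).eval
          (standardPoly p μ a (Fin.natAdd r i)) := by
  have hg := givesRiseTo_standard h hμ
  have hQ : LinearIndependent (ZMod p) (standardPoly p μ a) :=
    (moore_ne_zero_iff _).1 (moore_ne_zero_of_leadingCoeff hg.natDegree_eq hg.moore_leadingCoeff)
  have hQ1 := linearIndependent_castAdd hQ
  set P := structuralPoly (Submodule.span (ZMod p)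
    (Set.range fun j : Fin r => standardPoly p μ a (Fin.castAdd t j))) with hP
  have hev (y : k[X]) : rat (P.eval y) = ∑ l ∈ Finset.range (r + 1),
      rat (P.coeff (p ^ l)) * rat y ^ p ^ l := by
    conv_lhs => rw [hP, structuralPoly_eq_sum hQ1, ← hP]
    simp [rat, eval_finsetSum]
  have hdual := hg.isMooreDual.additive (fun l => rat (P.coeff (p ^ l))) (by
      have : P.coeff (p ^ r) = 1 := by
        rw [← structuralPoly_natDegree hQ1]
        exact structuralPoly_monic hQ1
      simp only [this, rat, map_one]) (by
      intro j
      have h0 := structuralPoly_eval_comb hQ1 (Pi.single j 1)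
      rw [comb, Finset.sum_eq_single j (fun l _ hl => by simp [hl]) (by simp)] at h0
      simp only [Pi.single_eq_same, one_smul] at h0
      rw [← hev, hP, h0, rat, map_zero])
  simp only [← hev] at hdual
  have hdual' := (givesRiseTo_pullback h hμ' hη).isMooreDual
  simp only [← pullback_standardForm h] at hdual'
  have hli := linearIndependent_natAdd (linearIndependent_standardForm h)
  have := congrFun (eq_of_isMooreDual (T' := fun i => (-1) ^ r *
    P.eval (standardPoly p μ a (Fin.natAdd r i))) hli hdual' (by
      simpa only [rat, map_mul, map_pow, map_neg, map_one] using hdual)) i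
  rw [this, ← mul_assoc, ← mul_pow]
  simp

end Quotient

end LSpace

/-! ### Assembly of the proposition. -/

theorem mainTheorem10 (p : ℕ) [Fact p.Prime] (k : Type*) [Field k] [IsAlgClosed k]
    [Algebra (ZMod p) k] (r t : ℕ) (ht : 1 ≤ t) (hn : 1 < r + t)
    (a : Fin (r + t) → k) (ha : LSpace.moore p a ≠ 0)
    -- the span of the first `r` entries of `a`, its structural polynomial, and the images of
    -- the last `t` entries under it
    (A : Submodule (ZMod p) k)
    (hA : A = Submodule.span (ZMod p) (Set.range fun i : Fin r => a (Fin.castAdd t i)))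
    (S : k[X]) (hS : S = LSpace.structuralPoly A)
    (b : Fin t → k) (hb : b = fun i => S.eval (a (Fin.natAdd r i)))
    -- the usual bases of the two standard spaces and the polynomials attached to them
    (ω : Fin (r + t) → LSpace.Form k) (hω : ω = LSpace.standardForm (p := p) a)
    (ω' : Fin t → LSpace.Form k) (hω' : ω' = LSpace.standardForm (p := p) b)
    (μ : k) (hμ : μ ^ p ^ (r + t - 1) = -1 / LSpace.moore p a ^ (p - 1))
    (μ' : k) (hμ' : μ' ^ p ^ (t - 1) = -1 / LSpace.moore p b ^ (p - 1))
    (Q : Fin (r + t) → k[X]) (hQ : Q = LSpace.standardPoly p μ a)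
    (Q' : Fin t → k[X]) (hQ' : Q' = LSpace.standardPoly p μ' b)
    (η : k)
    (hη : η ^ p ^ (t - 1) = (-1) ^ r / LSpace.moore p (fun i : Fin r => a (Fin.castAdd t i)) ^ (p - 1)) :
    -- the first standard space
    (LSpace.IsLSpace ((p - 1) * p ^ (r + t - 1)) (r + t)
        (Submodule.span (ZMod p) (Set.range ω)) ∧
      LSpace.poles (Submodule.span (ZMod p) (Set.range ω)) =
        (Submodule.span (ZMod p) (Set.range a) : Set k) \ {0} ∧
      ∀ T : Fin (r + t) → k[X], LSpace.GivesRiseTo p (p - 1) T ω ↔ T = Q) ∧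
    -- the second standard space
    (LSpace.moore p b ≠ 0 ∧
      LSpace.IsLSpace ((p - 1) * p ^ (t - 1)) t (Submodule.span (ZMod p) (Set.range ω')) ∧
      LSpace.poles (Submodule.span (ZMod p) (Set.range ω')) =
        (Submodule.span (ZMod p) (Set.range b) : Set k) \ {0} ∧
      ∀ T : Fin t → k[X], LSpace.GivesRiseTo p (p - 1) T ω' ↔ T = Q') ∧
    -- `X ↦ S(X)` is étale on the affine line
    (LSpace.moore p (fun i : Fin r => a (Fin.castAdd t i)) ≠ 0 ∧
      derivative S =
        C ((-1) ^ r * LSpace.moore p (fun i : Fin r => a (Fin.castAdd t i)) ^ (p - 1))) ∧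
    -- the last `t` forms and their span are pulled back from the second standard space
    ((∀ i : Fin t, ω (Fin.natAdd r i) = LSpace.pullback S (ω' i)) ∧
      (Submodule.span (ZMod p) (Set.range fun i : Fin t => ω (Fin.natAdd r i)) :
          Set (LSpace.Form k)) =
        LSpace.pullback S '' (Submodule.span (ZMod p) (Set.range ω') : Set (LSpace.Form k)) ∧
      LSpace.IsLSpace ((p - 1) * p ^ (r + t - 1)) t
        (Submodule.span (ZMod p) (Set.range fun i : Fin t => ω (Fin.natAdd r i)))) ∧
    -- the `t`-tuple of polynomials attached to the pulled back basis
    (∀ T : Fin t → k[X],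
      LSpace.GivesRiseTo p ((p - 1) * p ^ r) T (fun i => LSpace.pullback S (ω' i)) ↔
        T = fun i => C η * (Q' i).comp S) ∧
    -- its relation with the structural polynomial of the span of the first `r` entries of `Q`
    (∀ i : Fin t, (-1) ^ r * (C η * (Q' i).comp S) =
      (LSpace.structuralPoly
        (Submodule.span (ZMod p) (Set.range fun j : Fin r => Q (Fin.castAdd t j)))).eval
          (Q (Fin.natAdd r i))) := by
  have hli := (LSpace.moore_ne_zero_iff a).1 ha
  have hb' : b = LSpace.tailImage p a := by
    rw [hb, hS, hA, LSpace.tailImage_def, LSpace.headPoly_def]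
  have hS' : S = LSpace.headPoly p a := by rw [hS, hA, LSpace.headPoly_def]
  have hbli := LSpace.linearIndependent_tailImage hli
  have hdeg := LSpace.headPoly_natDegree_ne_zero hli
  have hlast := LSpace.linearIndependent_natAdd (LSpace.linearIndependent_standardForm hli)
  clear hb hS hA
  subst hb' hS' hω hω' hQ hQ'
  refine ⟨⟨LSpace.isLSpace_standard hli, LSpace.poles_standard hli,
      (LSpace.givesRiseTo_standard hli hμ).iff_eq (LSpace.linearIndependent_standardForm hli)⟩,
    ⟨(LSpace.moore_ne_zero_iff _).2 hbli, LSpace.isLSpace_standard hbli,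
      LSpace.poles_standard hbli,
      (LSpace.givesRiseTo_standard hbli hμ').iff_eq (LSpace.linearIndependent_standardForm hbli)⟩,
    ⟨(LSpace.moore_ne_zero_iff _).2 (LSpace.linearIndependent_castAdd hli),
      LSpace.headPoly_derivative hli⟩,
    ⟨LSpace.pullback_standardForm hli, ?_, ?_⟩, ?_, ?_⟩
  · simp only [LSpace.pullback_standardForm hli]
    have := congrArg (SetLike.coe (B := LSpace.Form k)) (Submodule.map_span
      (LSpace.pullbackLinear p _ hdeg)
      (Set.range (LSpace.standardForm (p := p) (LSpace.tailImage p a))))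
    rw [Submodule.map_coe, ← Set.range_comp] at this
    exact this.symm
  · refine (LSpace.isLSpace_standard hli).of_le (Submodule.span_mono ?_) ?_
    · rintro _ ⟨i, rfl⟩
      exact ⟨_, rfl⟩
    · rw [finrank_span_eq_card hlast, Fintype.card_fin]
  · simp only [LSpace.pullback_standardForm hli] at hlast
    exact (LSpace.givesRiseTo_pullback hli hμ' hη).iff_eq hlast
  · exact LSpace.pulled_eq_structuralPoly_eval hli hμ hμ' hη
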